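/- Let $(X,\omega)$ be a connected symplectic manifold and let $C^\infty(X)$ denote the smooth $\mathbb C$-valued functions. For $\varphi\in C^\infty(X)$ the (complex) Hamiltonian vector field $\xi_\varphi$ is defined by $\eta\varphi=\omega(\xi_\varphi,\eta)$ for all vector fields $\eta$, and $[\varphi,\psi]=\xi_\varphi\psi$ is the Poisson bracket; the same conventions are used on every symplectic manifold. Assume $X$ is integral, and let $L\to X$ be a quantum line bundle: a smooth Hermitian complex line bundle with a connection $\nabla$ that preserves the Hermitian structure and has curvature $\omega$, in the following sense. Let $\tau:L^1\to X$ be the principal $U(1)$-bundle of unit circles in the fibers of $L$, and let $\alpha$ be the connection form of $\nabla$, i.e. the real $U(1)$-invariant $1$-form on $L^1$ which is $d\theta/2\pi$ on each fiber and satisfies $\nabla_\xi s=2\pi i\,\langle s^*\alpha,\xi\rangle\, s$ for all local smooth sections $s$ of $L^1$ and all vector fields $\xi$; then $d\alpha=\tau^*\omega$. Let $S$ be the space of smooth sections of $L$ and, for $\varphi\in C^\infty(X)$, $s\in S$, put $\pi(\varphi)s=(\nabla_{\xi_\varphi}+2\pi i\varphi)s$. For $s\in S$ let $\tilde s\in C^\infty(L^1)$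 be the function with $s(\tau(q))=\tilde s(q)\,q$, and let $\tilde\varphi=\varphi\circ\tau$. Let $\zeta$ be the vertical vector field on $L^1$ with $\langle\alpha,\zeta\rangle=-1$, let $\tilde\xi$ denote the horizontal lift to $L^1$ of a vector field $\xi$ on $X$ (so $\langle\alpha,\tilde\xi\rangle=0$ and $\tau_*\tilde\xi=\xi$), and let $\eta_\varphi=\tilde\xi_\varphi+\tilde\varphi\,\zeta$. Put $\tilde X=L^1\times\mathbb R^+$, let $r$ be the coordinate on $\mathbb R^+$, and let $\omega_{\tilde X}=d(r\alpha)$; functions, forms and vector fields on the factors are extended to $\tilde X$ in the obvious way. Then $(\tilde X,\omega_{\tilde X})$ is a symplectic manifold, and the map $$C^\infty(X)\to C^\infty(\tilde X),\qquad \varphi\mapsto r\tilde\varphi,$$ is a monomorphism of Poisson Lie algebras. Moreover, for every $\varphi\in C^\infty(X)$, $\eta_\varphi$ is a Hamiltonian vector field on $\tilde X$; in fact $\eta_\varphi=\xi_{r\tilde\varphi}$. Finally, for all $s\in S$ and $\varphi\in C^\infty(X)$, $$\widetilde{\pi(\varphi)(s)}=[r\tilde\varphi,\tilde s].$$ -/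

import Mathlib

open scoped Manifold ContDiff TensorProduct
open Bundle

noncomputable section

/-! ### Complexification of tangent spaces and forms -/

namespace Complexify

variable {V : Type*} [AddCommGroup V] [Module ℝ V] [TopologicalSpace V]

/-- The `ℂ`-linear extension to `ℂ ⊗[ℝ] V` of a real-valued `1`-form on `V`. -/
def oneForm (α : V [⋀^Fin 1]→L[ℝ] ℝ) : ℂ ⊗[ℝ] V →ₗ[ℂ] ℂ :=
  LinearMap.liftBaseChange ℂ
    ((Algebra.linearMap ℝ ℂ).comp
      ({ toFun := fun v => α ![v]
         map_add' := fun u v => α.toAlternatingMap.map_vecCons_add ![] u v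
         map_smul' := fun c v => α.toAlternatingMap.map_vecCons_smul ![] c v } : V →ₗ[ℝ] ℝ))

/-- A `2`-form on `V` as a bilinear form. -/
def bilin (Ω : V [⋀^Fin 2]→L[ℝ] ℝ) : LinearMap.BilinForm ℝ V :=
  have swap : ∀ u v : V, Ω ![u, v] = -Ω ![v, u] := fun u v => by
    have h := Ω.toAlternatingMap.map_swap ![v, u] (i := 0) (j := 1) (by decide)
    have e : (![v, u] ∘ Equiv.swap (0 : Fin 2) 1) = ![u, v] := by
      ext i; fin_cases i <;> simp
    rw [e] at h
    exact h
  LinearMap.mk₂ ℝ (fun u v => Ω ![u, v])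
    (fun u u' v => Ω.toAlternatingMap.map_vecCons_add ![v] u u')
    (fun c u v => Ω.toAlternatingMap.map_vecCons_smul ![v] c u)
    (fun u v v' => by
      have h : Ω ![v + v', u] = Ω ![v, u] + Ω ![v', u] :=
        Ω.toAlternatingMap.map_vecCons_add ![u] v v'
      rw [swap u (v + v'), h, swap u v, swap u v', neg_add])
    (fun c u v => by
      have h : Ω ![c • v, u] = c • Ω ![v, u] :=
        Ω.toAlternatingMap.map_vecCons_smul ![u] c v
      rw [swap u (c • v), h, swap u v, smul_neg])

/-- The `ℂ`-bilinear extension to `ℂ ⊗[ℝ] V` of a real-valued `2`-form on `V`. -/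
def twoForm (Ω : V [⋀^Fin 2]→L[ℝ] ℝ) : LinearMap.BilinForm ℂ (ℂ ⊗[ℝ] V) :=
  LinearMap.BilinForm.baseChange ℂ (bilin Ω)

end Complexify

/-! ### Differential forms and Poisson brackets on manifolds without boundary -/

section Manifolds

variable {E : Type*} [NormedAddCommGroup E] [NormedSpace ℝ E]
  {H : Type*} [TopologicalSpace H] (I : ModelWithCorners ℝ E H)
  (M : Type*) [TopologicalSpace M] [ChartedSpace H M]

/-- Real differential `k`-forms on `M` (no regularity is built in). -/
abbrev DiffForm (k : ℕ) : Type _ :=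
  Π x : M, TangentSpace I x [⋀^Fin k]→L[ℝ] ℝ

/-- Complex tangent vectors at `x`. -/
abbrev CTangent {M : Type*} [TopologicalSpace M] [ChartedSpace H M] (x : M) : Type _ :=
  ℂ ⊗[ℝ] TangentSpace I x

variable {I M}

namespace DiffForm

/-- The expression of a `k`-form in the chart around `x`: its pullback under the inverse chart. -/
def inChart {k : ℕ} (Ω : DiffForm I M k) (x : M) : E → E [⋀^Fin k]→L[ℝ] ℝ := fun y =>
  (Ω ((extChartAt I x).symm y)).compContinuousLinearMap
    (mfderiv 𝓘(ℝ, E) I (extChartAt I x).symm y)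

/-- A form is smooth if all its expressions in charts are. -/
def IsSmooth {k : ℕ} (Ω : DiffForm I M k) : Prop :=
  ∀ x : M, ContDiffOn ℝ ∞ (Ω.inChart x) (extChartAt I x).target

/-- The exterior derivative of a form, computed at `x` in the chart around `x`. -/
def d {k : ℕ} (Ω : DiffForm I M k) : DiffForm I M (k + 1) := fun x =>
  (extDeriv (Ω.inChart x) (extChartAt I x x)).compContinuousLinearMap
    (mfderiv I 𝓘(ℝ, E) (extChartAt I x) x)

/-- The pullback of a form under a map. -/
def pullback {E' : Type*} [NormedAddCommGroup E'] [NormedSpace ℝ E']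
    {H' : Type*} [TopologicalSpace H'] {I' : ModelWithCorners ℝ E' H'}
    {M' : Type*} [TopologicalSpace M'] [ChartedSpace H' M'] {k : ℕ}
    (f : M' → M) (Ω : DiffForm I M k) : DiffForm I' M' k := fun x =>
  (Ω (f x)).compContinuousLinearMap (mfderiv I' I f x)

/-- Symplectic forms: smooth, closed, non-degenerate `2`-forms. -/
structure IsSymplectic (Ω : DiffForm I M 2) : Prop where
  smooth : Ω.IsSmooth
  closed : ∀ x, Ω.d x = 0
  nondegenerate : ∀ (x : M) (u : TangentSpace I x), (∀ v, Ω x ![u, v] = 0) → u = 0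

end DiffForm

/-- Smooth complex-valued functions on `M`. -/
def IsSmoothFun (I : ModelWithCorners ℝ E H) (f : M → ℂ) : Prop :=
  ContMDiff I 𝓘(ℝ, ℂ) ∞ f

/-- The derivative of a complex-valued function in the direction of complex tangent vectors. -/
def cderiv (I : ModelWithCorners ℝ E H) (f : M → ℂ) (x : M) : CTangent I x →ₗ[ℂ] ℂ :=
  LinearMap.liftBaseChange ℂ (mvfderiv I f x : TangentSpace I x →ₗ[ℝ] ℂ)

/-- `ξ` is a Hamiltonian vector field of `f`: `η f = Ω(ξ, η)` for all complex tangent vectors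
`η`. -/
def IsHamiltonianField (Ω : DiffForm I M 2) (f : M → ℂ) (ξ : Π x : M, CTangent I x) : Prop :=
  ∀ (x : M) (η : CTangent I x), cderiv I f x η = Complexify.twoForm (Ω x) (ξ x) η

/-- The Hamiltonian vector field `ξ_f` of `f`: at each point the complex tangent vector `ξ` with
`η f = Ω(ξ, η)` for all `η` (unique if `Ω` is symplectic). -/
def hamiltonianField (Ω : DiffForm I M 2) (f : M → ℂ) (x : M) : CTangent I x :=
  Classical.epsilon fun ξ =>
    ∀ η : CTangent I x, cderiv I f x η = Complexify.twoForm (Ω x) ξ η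

/-- The Poisson bracket `[f, g] = ξ_f g`. -/
def poissonBracket (Ω : DiffForm I M 2) (f g : M → ℂ) : M → ℂ := fun x =>
  cderiv I g x (hamiltonianField Ω f x)

/-- The smooth complex-valued functions form a Poisson Lie algebra over `ℂ` under the Poisson
bracket of `Ω`. -/
structure IsPoissonLieAlgebra (Ω : DiffForm I M 2) : Prop where
  smooth : ∀ f g : M → ℂ, IsSmoothFun I f → IsSmoothFun I g → IsSmoothFun I (poissonBracket Ω f g)
  add_left : ∀ f g h : M → ℂ, IsSmoothFun I f → IsSmoothFun I g → IsSmoothFun I h →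
    poissonBracket Ω (f + g) h = poissonBracket Ω f h + poissonBracket Ω g h
  smul_left : ∀ (c : ℂ) (f g : M → ℂ), IsSmoothFun I f → IsSmoothFun I g →
    poissonBracket Ω (c • f) g = c • poissonBracket Ω f g
  add_right : ∀ f g h : M → ℂ, IsSmoothFun I f → IsSmoothFun I g → IsSmoothFun I h →
    poissonBracket Ω f (g + h) = poissonBracket Ω f g + poissonBracket Ω f h
  smul_right : ∀ (c : ℂ) (f g : M → ℂ), IsSmoothFun I f → IsSmoothFun I g →
    poissonBracket Ω f (c • g) = c • poissonBracket Ω f g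
  self : ∀ f : M → ℂ, IsSmoothFun I f → poissonBracket Ω f f = 0
  jacobi : ∀ f g h : M → ℂ, IsSmoothFun I f → IsSmoothFun I g → IsSmoothFun I h →
    poissonBracket Ω f (poissonBracket Ω g h) + poissonBracket Ω g (poissonBracket Ω h f)
      + poissonBracket Ω h (poissonBracket Ω f g) = 0
  leibniz : ∀ f g h : M → ℂ, IsSmoothFun I f → IsSmoothFun I g → IsSmoothFun I h →
    poissonBracket Ω f (g * h) = poissonBracket Ω f g * h + g * poissonBracket Ω f h

/-- `Φ` restricts to an injective homomorphism of Poisson Lie algebras from the smooth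
complex-valued functions on `M` to those on `M'`. -/
structure IsPoissonLieMonomorphism {E' : Type*} [NormedAddCommGroup E'] [NormedSpace ℝ E']
    {H' : Type*} [TopologicalSpace H'] {I' : ModelWithCorners ℝ E' H'}
    {M' : Type*} [TopologicalSpace M'] [ChartedSpace H' M']
    (Ω : DiffForm I M 2) (Ω' : DiffForm I' M' 2) (Φ : (M → ℂ) → (M' → ℂ)) : Prop where
  smooth : ∀ f, IsSmoothFun I f → IsSmoothFun I' (Φ f)
  map_add : ∀ f g, IsSmoothFun I f → IsSmoothFun I g → Φ (f + g) = Φ f + Φ g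
  map_smul : ∀ (c : ℂ) (f), IsSmoothFun I f → Φ (c • f) = c • Φ f
  injective : Set.InjOn Φ {f | IsSmoothFun I f}
  map_bracket : ∀ f g, IsSmoothFun I f → IsSmoothFun I g →
    Φ (poissonBracket Ω f g) = poissonBracket Ω' (Φ f) (Φ g)

end Manifolds

/-! ### Hermitian line bundles with connection -/

section LineBundle

variable {E : Type*} [NormedAddCommGroup E] [NormedSpace ℝ E]
  {H : Type*} [TopologicalSpace H] (I : ModelWithCorners ℝ E H)
  {X : Type*} [TopologicalSpace X] [ChartedSpace H X] [IsManifold I ∞ X]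
  (L : X → Type*) [TopologicalSpace (TotalSpace ℂ L)]
  [∀ x, NormedAddCommGroup (L x)] [∀ x, InnerProductSpace ℂ (L x)]
  [FiberBundle ℂ L] [VectorBundle ℝ ℂ L] [VectorBundle ℂ ℂ L] [ContMDiffVectorBundle ∞ ℂ L I]

/-- The section `s` of `L` is smooth on `U`. -/
def IsSmoothSectionOn {L : X → Type*} [TopologicalSpace (TotalSpace ℂ L)]
    [∀ x, NormedAddCommGroup (L x)] [FiberBundle ℂ L] (s : Π x, L x) (U : Set X) : Prop :=
  ContMDiffOn I (I.prod 𝓘(ℝ, ℂ)) ∞ (fun x => TotalSpace.mk' ℂ x (s x)) U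

/-- The Hermitian inner products on the fibers of `L` depend smoothly on the base point. -/
def IsSmoothHermitian : Prop :=
  ∀ (U : Set X) (s t : Π x, L x), IsOpen U → IsSmoothSectionOn I s U → IsSmoothSectionOn I t U →
    ContMDiffOn I 𝓘(ℝ, ℂ) ∞ (fun x => inner ℂ (s x) (t x)) U

variable {I L}

/-- Smooth `ℂ`-linear connections for which the Hermitian structure is parallel.
In Mathlib's convention `nabla s x v` is `∇_v s`, the value at `x`. -/
structure IsHermitianConnection (nabla : CovariantDerivative I ℂ L) : Prop where
  smooth : ContMDiffCovariantDerivativeOn ℂ ∞ nabla.toFun Set.univ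
  smul : ∀ (c : ℂ) (s : Π x, L x) (x : X) (v : TangentSpace I x),
    MDifferentiableAt I (I.prod 𝓘(ℝ, ℂ)) (fun x => TotalSpace.mk' ℂ x (s x)) x →
    nabla (fun y => c • s y) x v = c • nabla s x v
  metric : ∀ (s t : Π x, L x) (x : X) (v : TangentSpace I x),
    MDifferentiableAt I (I.prod 𝓘(ℝ, ℂ)) (fun x => TotalSpace.mk' ℂ x (s x)) x →
    MDifferentiableAt I (I.prod 𝓘(ℝ, ℂ)) (fun x => TotalSpace.mk' ℂ x (t x)) x →
    mvfderiv I (fun y => inner ℂ (s y) (t y)) x v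
      = inner ℂ (nabla s x v) (t x) + inner ℂ (s x) (nabla t x v)

/-- Prequantization: `π(φ) s = (∇_{ξ_φ} + 2πi φ) s`, where `∇` is extended `ℂ`-linearly to complex
tangent vectors. -/
def prequantization (Ω : DiffForm I X 2) (nabla : CovariantDerivative I ℂ L)
    (φ : X → ℂ) (s : Π x, L x) : Π x, L x := fun x =>
  LinearMap.liftBaseChange ℂ (nabla s x : TangentSpace I x →ₗ[ℝ] L x) (hamiltonianField Ω φ x)
    + (2 * Real.pi * Complex.I * φ x) • s x

end LineBundle

/-! ### The circle bundle and its connection form -/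

section CircleBundle

/-- The circle bundle `L¹`: the unit vectors in the fibers of `L`, with the topology induced by the
total space of `L`. -/
abbrev CircleBundle {X : Type*} (L : X → Type*) [∀ x, NormedAddCommGroup (L x)] : Type _ :=
  {v : TotalSpace ℂ L // ‖v.2‖ = 1}

namespace CircleBundle

variable {X : Type*} {L : X → Type*} [∀ x, NormedAddCommGroup (L x)]

/-- The bundle projection `τ : L¹ → X`. -/
def τ (q : CircleBundle L) : X := q.1.1

variable [∀ x, InnerProductSpace ℂ (L x)]

/-- The action of `U(1)` on `L¹` by scalar multiplication. -/
instance : SMul Circle (CircleBundle L) where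
  smul c q := ⟨⟨q.1.1, (c : ℂ) • q.1.2⟩, by
    change ‖(c : ℂ) • q.1.2‖ = 1
    rw [norm_smul, Circle.norm_coe, q.2, one_mul]⟩

/-- The function `s̃` on `L¹` defined by a section `s` of `L`. As the fiber is a line spanned by the
unit vector `q`, it is the function with `s (τ q) = s̃ q • q`, and `s̃ (c • q) = c⁻¹ * s̃ q`. -/
def tildeSection (s : Π x, L x) (q : CircleBundle L) : ℂ :=
  inner ℂ q.1.2 (s q.1.1)

end CircleBundle

open CircleBundle

variable {E : Type*} [NormedAddCommGroup E] [NormedSpace ℝ E]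
  {H : Type*} [TopologicalSpace H] {I : ModelWithCorners ℝ E H}
  {X : Type*} [TopologicalSpace X] [ChartedSpace H X] [IsManifold I ∞ X]
  {L : X → Type*} [TopologicalSpace (TotalSpace ℂ L)]
  [∀ x, NormedAddCommGroup (L x)] [∀ x, InnerProductSpace ℂ (L x)]
  [FiberBundle ℂ L] [VectorBundle ℝ ℂ L] [VectorBundle ℂ ℂ L] [ContMDiffVectorBundle ∞ ℂ L I]
  {E₁ : Type*} [NormedAddCommGroup E₁] [NormedSpace ℝ E₁]
  {H₁ : Type*} [TopologicalSpace H₁] {J : ModelWithCorners ℝ E₁ H₁}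
  [ChartedSpace H₁ (CircleBundle L)]

/-- `α` is the connection form on `L¹` of the connection `∇`: a smooth real `U(1)`-invariant
`1`-form which on each fiber is `dθ/2π`, with `∇_v s = 2πi ⟨s^*α, v⟩ s` for every smooth local
section `s` of `L¹`. -/
structure IsConnectionForm (nabla : CovariantDerivative I ℂ L)
    (α : DiffForm J (CircleBundle L) 1) : Prop where
  smooth : α.IsSmooth
  invariant : ∀ c : Circle, DiffForm.pullback (fun q : CircleBundle L => c • q) α = α
  fiber : ∀ (q : CircleBundle L) (θ : ℝ),
    α (Circle.exp θ • q)
      ![mfderiv 𝓘(ℝ, ℝ) J (fun t : ℝ => Circle.exp t • q) θ (1 : ℝ)] = 1 / (2 * Real.pi)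
  covariantDerivative : ∀ (U : Set X) (s : Π x, L x) (σ : X → CircleBundle L),
    IsOpen U → ContMDiffOn I J ∞ σ U → (∀ x ∈ U, (σ x).1 = ⟨x, s x⟩) →
    ∀ x ∈ U, ∀ v : TangentSpace I x,
      nabla s x v
        = (2 * Real.pi * Complex.I * (α (σ x) ![mfderiv I J σ x v] : ℝ) : ℂ) • s x

variable (I)

/-- The vertical vector field `ζ` on `L¹` with `⟨α, ζ⟩ = -1`. -/
def verticalField (α : DiffForm J (CircleBundle L) 1) (q : CircleBundle L) : TangentSpace J q :=
  Classical.epsilon fun w => mfderiv J I (τ : CircleBundle L → X) q w = 0 ∧ α q ![w] = -1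

/-- The horizontal lift `ξ̃` to `L¹` of a complex vector field `ξ` on `X`: `⟨α, ξ̃⟩ = 0` and
`τ_* ξ̃ = ξ`. -/
def horizontalLift (α : DiffForm J (CircleBundle L) 1) (ξ : Π x : X, CTangent I x)
    (q : CircleBundle L) : CTangent J q :=
  Classical.epsilon fun w =>
    Complexify.oneForm (α q) w = 0 ∧
    LinearMap.baseChange ℂ
      (mfderiv J I (τ : CircleBundle L → X) q : TangentSpace J q →ₗ[ℝ] TangentSpace I (τ q)) w
      = ξ (τ q)

variable {I}

/-- The vector field `η_φ = ξ̃_φ + φ̃ ζ` on `L¹`, with `φ̃ = φ ∘ τ`. -/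
def etaField (Ω : DiffForm I X 2) (α : DiffForm J (CircleBundle L) 1) (φ : X → ℂ)
    (q : CircleBundle L) : CTangent J q :=
  horizontalLift I α (hamiltonianField Ω φ) q + φ (τ q) • ((1 : ℂ) ⊗ₜ[ℝ] verticalField I α q)

/-! ### Symplectic induction -/

/-- The manifold `ℝ⁺` of positive real numbers. -/
abbrev PosReals : TopologicalSpace.Opens ℝ := ⟨Set.Ioi 0, isOpen_Ioi⟩

/-- The manifold `X̃ = L¹ × ℝ⁺`. -/
abbrev InducedSpace {X : Type*} (L : X → Type*) [∀ x, NormedAddCommGroup (L x)] : Type _ :=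
  CircleBundle L × PosReals

/-- The `1`-form `r α` on `X̃`. -/
def rAlpha (α : DiffForm J (CircleBundle L) 1) : DiffForm (J.prod 𝓘(ℝ, ℝ)) (InducedSpace L) 1 :=
  fun p => (p.2 : ℝ) • DiffForm.pullback (I' := J.prod 𝓘(ℝ, ℝ))
    (Prod.fst : InducedSpace L → CircleBundle L) α p

/-- The symplectic form `d(r α)` of `X̃`. -/
def inducedForm (α : DiffForm J (CircleBundle L) 1) :
    DiffForm (J.prod 𝓘(ℝ, ℝ)) (InducedSpace L) 2 :=
  (rAlpha α).d

/-- The function `r φ̃` on `X̃` defined by a function `φ` on `X`. -/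
def rTilde (φ : X → ℂ) : InducedSpace L → ℂ := fun p => ((p.2 : ℝ) : ℂ) * φ (τ p.1)

/-- The extension to `X̃ = L¹ × ℝ⁺` of a complex vector field on `L¹`. -/
def extendField (η : Π q : CircleBundle L, CTangent J q) (p : InducedSpace L) :
    CTangent (J.prod 𝓘(ℝ, ℝ)) p :=
  LinearMap.baseChange ℂ
    (mfderiv J (J.prod 𝓘(ℝ, ℝ)) (fun q : CircleBundle L => ((q, p.2) : InducedSpace L)) p.1 :
      TangentSpace J p.1 →ₗ[ℝ] TangentSpace (J.prod 𝓘(ℝ, ℝ)) p) (η p.1)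

/-- The extension to `X̃ = L¹ × ℝ⁺` of the function `s̃` on `L¹`. -/
def tildeSectionExt (s : Π x, L x) : InducedSpace L → ℂ := fun p => tildeSection s p.1

end CircleBundle

end

section

open scoped Manifold ContDiff TensorProduct Topology
open Bundle Set Filter

set_option linter.unusedSectionVars false

/-! ### Exterior derivatives of forms on manifolds without boundary -/

theorem minSmoothness_two_le_infty : minSmoothness ℝ 2 ≤ (∞ : WithTop ℕ∞) := by
  rw [minSmoothness_of_isRCLikeNormedField]
  exact WithTop.coe_le_coe.2 (by exact_mod_cast (le_top : (2 : ℕ∞) ≤ ⊤))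

section Forms

variable {E : Type*} [NormedAddCommGroup E] [NormedSpace ℝ E]
  {H : Type*} [TopologicalSpace H] {I : ModelWithCorners ℝ E H}
  {M : Type*} [TopologicalSpace M] [ChartedSpace H M]
  {E' : Type*} [NormedAddCommGroup E'] [NormedSpace ℝ E']
  {H' : Type*} [TopologicalSpace H'] {I' : ModelWithCorners ℝ E' H'}
  {M' : Type*} [TopologicalSpace M'] [ChartedSpace H' M']
  {E'' : Type*} [NormedAddCommGroup E''] [NormedSpace ℝ E'']
  {H'' : Type*} [TopologicalSpace H''] {I'' : ModelWithCorners ℝ E'' H''}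
  {M'' : Type*} [TopologicalSpace M''] [ChartedSpace H'' M'']

namespace DiffForm

variable {k : ℕ}

theorem compContinuousLinearMap_congr (Ω : DiffForm I M k) {F : Type*} [NormedAddCommGroup F]
    [NormedSpace ℝ F] {a b : M} (h : a = b) {A B : F →L[ℝ] E} (hAB : A = B) :
    (Ω a : E [⋀^Fin k]→L[ℝ] ℝ).compContinuousLinearMap A
      = (Ω b : E [⋀^Fin k]→L[ℝ] ℝ).compContinuousLinearMap B := by
  subst h; subst hAB; rfl

theorem apply_congr (Ω : DiffForm I M k) {a b : M} (h : a = b) (v : Fin k → E) :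
    (Ω a : E [⋀^Fin k]→L[ℝ] ℝ) v = (Ω b : E [⋀^Fin k]→L[ℝ] ℝ) v := by
  subst h; rfl

theorem pullback_congr (Ω : DiffForm I M k) {f g : M' → M} {x : M'} (h : f =ᶠ[𝓝 x] g) :
    pullback (I' := I') f Ω x = pullback (I' := I') g Ω x :=
  compContinuousLinearMap_congr (F := E') Ω h.eq_of_nhds h.mfderiv_eq

theorem pullback_comp (Ω : DiffForm I M k) {f : M' → M} {g : M'' → M'} {x : M''}
    (hf : MDifferentiableAt I' I f (g x)) (hg : MDifferentiableAt I'' I' g x) :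
    pullback (I' := I'') (f ∘ g) Ω x
      = pullback (I' := I'') g (pullback (I' := I') f Ω) x := by
  unfold pullback
  rw [mfderiv_comp x hf hg]
  rfl

theorem inChart_eq_pullback (Ω : DiffForm I M k) (x : M) :
    Ω.inChart x = pullback (I' := 𝓘(ℝ, E)) (extChartAt I x).symm Ω := rfl

theorem mfderiv_extChartAt_self' [IsManifold I ∞ M] (x : M) :
    mfderiv I 𝓘(ℝ, E) (extChartAt I x) x = ContinuousLinearMap.id ℝ E := by
  have : IsManifold I 1 M := IsManifold.of_le (n := ∞) (by simp)
  exact mfderiv_extChartAt_self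

theorem d_eq_extDeriv [IsManifold I ∞ M] (Ω : DiffForm I M k) (x : M) :
    Ω.d x = extDeriv (Ω.inChart x) (extChartAt I x x) := by
  unfold d
  rw [mfderiv_extChartAt_self' x]
  ext v; rfl

variable [I.Boundaryless]

theorem extChartAt_target_mem_nhds_of_mem {x : M} {y : E} (hy : y ∈ (extChartAt I x).target) :
    (extChartAt I x).target ∈ 𝓝 y :=
  (isOpen_extChartAt_target x).mem_nhds hy

theorem IsSmooth.contDiffAt_inChart {Ω : DiffForm I M k} (hΩ : Ω.IsSmooth) {x : M} {y : E}
    (hy : y ∈ (extChartAt I x).target) : ContDiffAt ℝ ∞ (Ω.inChart x) y :=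
  (hΩ x).contDiffAt (extChartAt_target_mem_nhds_of_mem hy)

variable [IsManifold I ∞ M]

theorem contMDiffAt_extChartAt_symm {x : M} {y : E} (hy : y ∈ (extChartAt I x).target) :
    ContMDiffAt 𝓘(ℝ, E) I ∞ (extChartAt I x).symm y :=
  (contMDiffOn_extChartAt_symm x).contMDiffAt (extChartAt_target_mem_nhds_of_mem hy)

theorem mdifferentiableAt_extChartAt_symm {x : M} {y : E} (hy : y ∈ (extChartAt I x).target) :
    MDifferentiableAt 𝓘(ℝ, E) I (extChartAt I x).symm y :=
  (contMDiffAt_extChartAt_symm hy).mdifferentiableAt (by simp)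

theorem mfderiv_extChartAt_symm_self (x : M) :
    mfderiv 𝓘(ℝ, E) I (extChartAt I x).symm (extChartAt I x x) = ContinuousLinearMap.id ℝ E := by
  have : IsManifold I 1 M := IsManifold.of_le (n := ∞) (by simp)
  have h := mfderivWithin_range_extChartAt_symm (I := I) (x := x)
  rw [I.range_eq_univ, mfderivWithin_univ] at h
  exact h

theorem inChart_self (Ω : DiffForm I M k) (x : M) :
    Ω.inChart x (extChartAt I x x) = Ω x := by
  refine (compContinuousLinearMap_congr (F := E) Ω (extChartAt_to_inv (I := I) x)
    (mfderiv_extChartAt_symm_self x)).trans ?_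
  ext v; rfl

/-- The change of charts from the chart at `x` to the chart at `x'`. -/
theorem contDiffAt_extChartAt_comp_symm {x x' : M} {y : E} (hy : y ∈ (extChartAt I x).target)
    (hy' : (extChartAt I x).symm y ∈ (extChartAt I x').source) :
    ContDiffAt ℝ ∞ (extChartAt I x' ∘ (extChartAt I x).symm) y := by
  rw [← contMDiffAt_iff_contDiffAt]
  rw [extChartAt_source] at hy'
  exact (contMDiffAt_extChartAt' hy').comp y (contMDiffAt_extChartAt_symm hy)

theorem inChart_eq_inChart (Ω : DiffForm I M k) {x x' : M} {y : E}
    (hy : y ∈ (extChartAt I x).target)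
    (hy' : (extChartAt I x).symm y ∈ (extChartAt I x').source) :
    Ω.inChart x y = (Ω.inChart x' ((extChartAt I x' ∘ (extChartAt I x).symm) y)).compContinuousLinearMap
      (fderiv ℝ (extChartAt I x' ∘ (extChartAt I x).symm) y) := by
  have h : ((extChartAt I x).symm : E → M) =ᶠ[𝓝 y]
      (extChartAt I x').symm ∘ (extChartAt I x' ∘ (extChartAt I x).symm) := by
    have h1 : (extChartAt I x).symm ⁻¹' (extChartAt I x').source ∈ 𝓝 y :=
      (contMDiffAt_extChartAt_symm hy).continuousAt.preimage_mem_nhds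
        ((isOpen_extChartAt_source x').mem_nhds hy')
    filter_upwards [h1] with z hz
    exact ((extChartAt I x').left_inv hz).symm
  have hT := (contDiffAt_extChartAt_comp_symm hy hy').differentiableAt (by simp)
  rw [inChart_eq_pullback, pullback_congr Ω h,
    pullback_comp (I' := 𝓘(ℝ, E)) (f := (extChartAt I x').symm)
      (g := extChartAt I x' ∘ (extChartAt I x).symm) Ω
      (mdifferentiableAt_extChartAt_symm ((extChartAt I x').map_source hy'))
      hT.mdifferentiableAt, ← inChart_eq_pullback]
  unfold pullback
  rw [mfderiv_eq_fderiv]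
  rfl

/-- The exterior derivative can be computed in any chart. -/
theorem inChart_d {Ω : DiffForm I M k} (hΩ : Ω.IsSmooth) {x : M} {y : E}
    (hy : y ∈ (extChartAt I x).target) :
    Ω.d.inChart x y = extDeriv (Ω.inChart x) y := by
  set x' := (extChartAt I x).symm y with hx'
  have hxs : x' ∈ (extChartAt I x').source := mem_extChartAt_source x'
  have hT := contDiffAt_extChartAt_comp_symm hy hxs
  have hev : Ω.inChart x =ᶠ[𝓝 y] fun z =>
      (Ω.inChart x' ((extChartAt I x' ∘ (extChartAt I x).symm) z)).compContinuousLinearMap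
        (fderiv ℝ (extChartAt I x' ∘ (extChartAt I x).symm) z) := by
    have h1 : (extChartAt I x).symm ⁻¹' (extChartAt I x').source ∈ 𝓝 y :=
      (contMDiffAt_extChartAt_symm hy).continuousAt.preimage_mem_nhds
        ((isOpen_extChartAt_source x').mem_nhds hxs)
    filter_upwards [h1, extChartAt_target_mem_nhds_of_mem hy] with z hz hz'
    exact inChart_eq_inChart Ω hz' hz
  have hd : DifferentiableAt ℝ (Ω.inChart x') ((extChartAt I x' ∘ (extChartAt I x).symm) y) :=
    (hΩ.contDiffAt_inChart ((extChartAt I x').map_source hxs)).differentiableAt (by simp)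
  rw [hev.extDeriv_eq, extDeriv_pullback hd hT minSmoothness_two_le_infty]
  have hc : mfderiv 𝓘(ℝ, E) 𝓘(ℝ, E) (extChartAt I x' ∘ (extChartAt I x).symm) y
      = (mfderiv I 𝓘(ℝ, E) (extChartAt I x') x').comp
        (mfderiv 𝓘(ℝ, E) I (extChartAt I x).symm y) :=
    mfderiv_comp y ((contMDiffAt_extChartAt (n := ∞)).mdifferentiableAt (by simp))
      (mdifferentiableAt_extChartAt_symm hy)
  rw [mfderiv_eq_fderiv] at hc
  rw [hc]
  rfl

theorem IsSmooth.d {Ω : DiffForm I M k} (hΩ : Ω.IsSmooth) : Ω.d.IsSmooth := by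
  intro x
  have h : ContDiffOn ℝ ∞ (extDeriv (Ω.inChart x)) (extChartAt I x).target := by
    have := (hΩ x).fderiv_of_isOpen (m := ∞) (isOpen_extChartAt_target x) (by simp)
    exact (ContinuousAlternatingMap.alternatizeUncurryFinCLM ℝ E ℝ).contDiff.comp_contDiffOn this
  exact h.congr fun y hy => inChart_d hΩ hy

theorem d_d {Ω : DiffForm I M k} (hΩ : Ω.IsSmooth) (x : M) : Ω.d.d x = 0 := by
  rw [d_eq_extDeriv]
  have h : Ω.d.inChart x =ᶠ[𝓝 (extChartAt I x x)] extDeriv (Ω.inChart x) := by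
    filter_upwards [extChartAt_target_mem_nhds (I := I) x] with y hy
    exact inChart_d hΩ hy
  rw [h.extDeriv_eq]
  exact extDeriv_extDeriv_apply (hΩ.contDiffAt_inChart (mem_extChartAt_target x))
    minSmoothness_two_le_infty

end DiffForm

end Forms

/-! ### Complexified linear algebra -/

namespace Complexify

variable {V : Type*} [AddCommGroup V] [Module ℝ V]

/-- Complex vectors have a real and an imaginary part. -/
theorem exists_re_im (ξ : ℂ ⊗[ℝ] V) :
    ∃ a b : V, ξ = (1 : ℂ) ⊗ₜ[ℝ] a + Complex.I ⊗ₜ[ℝ] b := by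
  induction ξ with
  | zero => exact ⟨0, 0, by simp⟩
  | add ξ ξ' h h' =>
    obtain ⟨a, b, rfl⟩ := h
    obtain ⟨a', b', rfl⟩ := h'
    exact ⟨a + a', b + b', by simp only [TensorProduct.tmul_add]; abel⟩
  | tmul z u =>
    refine ⟨z.re • u, z.im • u, ?_⟩
    rw [← TensorProduct.smul_tmul, ← TensorProduct.smul_tmul, ← TensorProduct.add_tmul]
    congr 1
    simp

theorem linearMap_ext {W : Type*} [AddCommGroup W] [Module ℂ W] {f g : ℂ ⊗[ℝ] V →ₗ[ℂ] W}
    (h : ∀ v, f (1 ⊗ₜ[ℝ] v) = g (1 ⊗ₜ[ℝ] v)) (ξ : ℂ ⊗[ℝ] V) : f ξ = g ξ := by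
  induction ξ with
  | zero => simp
  | add ξ ξ' h h' => simp only [map_add, h, h']
  | tmul z u =>
    have e : z ⊗ₜ[ℝ] u = z • ((1 : ℂ) ⊗ₜ[ℝ] u) := by simp [TensorProduct.smul_tmul']
    rw [e, map_smul, map_smul, h]

variable [TopologicalSpace V]

@[simp]
theorem oneForm_tmul (α : V [⋀^Fin 1]→L[ℝ] ℝ) (z : ℂ) (v : V) :
    oneForm α (z ⊗ₜ[ℝ] v) = z * (α ![v] : ℝ) := by
  simp [oneForm]

@[simp]
theorem twoForm_tmul (Ω : V [⋀^Fin 2]→L[ℝ] ℝ) (z w : ℂ) (u v : V) :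
    twoForm Ω (z ⊗ₜ[ℝ] u) (w ⊗ₜ[ℝ] v) = z * w * (Ω ![u, v] : ℝ) := by
  simp [twoForm, bilin, mul_comm]

theorem apply_swap (Ω : V [⋀^Fin 2]→L[ℝ] ℝ) (u v : V) : Ω ![u, v] = -Ω ![v, u] := by
  have h := Ω.toAlternatingMap.map_swap ![v, u] (i := 0) (j := 1) (by decide)
  have e : (![v, u] ∘ Equiv.swap (0 : Fin 2) 1) = ![u, v] := by
    ext i; fin_cases i <;> simp
  rw [e] at h
  exact h

theorem twoForm_swap (Ω : V [⋀^Fin 2]→L[ℝ] ℝ) (ξ η : ℂ ⊗[ℝ] V) :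
    twoForm Ω ξ η = -twoForm Ω η ξ := by
  induction ξ with
  | zero => simp
  | add ξ ξ' h h' => simp only [map_add, LinearMap.add_apply, h, h', neg_add]
  | tmul z u =>
    induction η with
    | zero => simp
    | add η η' h h' => simp only [map_add, LinearMap.add_apply, h, h', neg_add]
    | tmul w v => rw [twoForm_tmul, twoForm_tmul, apply_swap]; push_cast; ring

theorem twoForm_self (Ω : V [⋀^Fin 2]→L[ℝ] ℝ) (ξ : ℂ ⊗[ℝ] V) : twoForm Ω ξ ξ = 0 := by
  have h := twoForm_swap Ω ξ ξ
  linear_combination h / 2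

theorem twoForm_injective {Ω : V [⋀^Fin 2]→L[ℝ] ℝ} (hΩ : ∀ u, (∀ v, Ω ![u, v] = 0) → u = 0)
    {ξ ξ' : ℂ ⊗[ℝ] V} (h : ∀ η, twoForm Ω ξ η = twoForm Ω ξ' η) : ξ = ξ' := by
  rw [← sub_eq_zero]
  have h0 : ∀ η, twoForm Ω (ξ - ξ') η = 0 := fun η => by
    rw [map_sub, LinearMap.sub_apply, h, sub_self]
  obtain ⟨a, b, hab⟩ := exists_re_im (ξ - ξ')
  rw [hab] at h0 ⊢
  have key : ∀ v, Ω ![a, v] = 0 ∧ Ω ![b, v] = 0 := fun v => by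
    have := h0 (1 ⊗ₜ[ℝ] v)
    rw [map_add, LinearMap.add_apply, twoForm_tmul, twoForm_tmul, Complex.ext_iff] at this
    simpa using this
  rw [hΩ a fun v => (key v).1, hΩ b fun v => (key v).2]
  simp

end Complexify

open Complexify

/-! ### Hamiltonian vector fields and Poisson brackets -/

section Poisson

variable {E : Type*} [NormedAddCommGroup E] [NormedSpace ℝ E]
  {H : Type*} [TopologicalSpace H] {I : ModelWithCorners ℝ E H}
  {M : Type*} [TopologicalSpace M] [ChartedSpace H M]

theorem cderiv_tmul (f : M → ℂ) (x : M) (z : ℂ) (v : TangentSpace I x) :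
    cderiv I f x (z ⊗ₜ[ℝ] v) = z * mvfderiv I f x v := by
  simp [cderiv]

theorem hamiltonianField_eq {Ω : DiffForm I M 2} {f : M → ℂ} {x : M}
    (hΩ : ∀ u : TangentSpace I x, (∀ v, Ω x ![u, v] = 0) → u = 0) {ξ : CTangent I x}
    (h : ∀ η : CTangent I x, cderiv I f x η = twoForm (Ω x) ξ η) :
    hamiltonianField Ω f x = ξ := by
  have hs := Classical.epsilon_spec (p := fun ξ : CTangent I x =>
    ∀ η : CTangent I x, cderiv I f x η = twoForm (Ω x) ξ η) ⟨ξ, h⟩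
  exact twoForm_injective hΩ fun η => (hs η).symm.trans (h η)

theorem exists_twoForm_eq [FiniteDimensional ℝ E] {Ω : DiffForm I M 2} {x : M}
    (hΩ : ∀ u : TangentSpace I x, (∀ v, Ω x ![u, v] = 0) → u = 0)
    (f : CTangent I x →ₗ[ℂ] ℂ) : ∃ ξ : CTangent I x, ∀ η, f η = twoForm (Ω x) ξ η := by
  have hfin : FiniteDimensional ℝ (TangentSpace I x) := inferInstanceAs (FiniteDimensional ℝ E)
  have hinj : Function.Injective (bilin (Ω x)) := by
    rw [injective_iff_map_eq_zero]
    exact fun u hu => hΩ u fun v => LinearMap.congr_fun hu v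
  have hsurj : Function.Surjective (bilin (Ω x)) :=
    (LinearMap.injective_iff_surjective_of_finrank_eq_finrank
      (Subspace.dual_finrank_eq (K := ℝ) (V := TangentSpace I x)).symm).1 hinj
  let g : TangentSpace I x →ₗ[ℝ] ℂ :=
    (f.restrictScalars ℝ).comp (TensorProduct.mk ℝ ℂ (TangentSpace I x) 1)
  obtain ⟨a, ha⟩ := hsurj (Complex.reLm.comp g)
  obtain ⟨b, hb⟩ := hsurj (Complex.imLm.comp g)
  refine ⟨(1 : ℂ) ⊗ₜ[ℝ] a + Complex.I ⊗ₜ[ℝ] b, linearMap_ext fun v => ?_⟩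
  have ha' : Ω x ![a, v] = (f (1 ⊗ₜ[ℝ] v)).re := LinearMap.congr_fun ha v
  have hb' : Ω x ![b, v] = (f (1 ⊗ₜ[ℝ] v)).im := LinearMap.congr_fun hb v
  rw [map_add, LinearMap.add_apply, twoForm_tmul, twoForm_tmul, ha', hb']
  simp [Complex.ext_iff]

theorem hamiltonianField_spec [FiniteDimensional ℝ E] {Ω : DiffForm I M 2} {x : M}
    (hΩ : ∀ u : TangentSpace I x, (∀ v, Ω x ![u, v] = 0) → u = 0) (f : M → ℂ)
    (η : CTangent I x) :
    cderiv I f x η = twoForm (Ω x) (hamiltonianField Ω f x) η :=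
  Classical.epsilon_spec (p := fun ξ : CTangent I x =>
    ∀ η : CTangent I x, cderiv I f x η = twoForm (Ω x) ξ η) (exists_twoForm_eq hΩ _) η

theorem cderiv_add {f g : M → ℂ} {x : M} (hf : MDifferentiableAt I 𝓘(ℝ, ℂ) f x)
    (hg : MDifferentiableAt I 𝓘(ℝ, ℂ) g x) :
    cderiv I (f + g) x = cderiv I f x + cderiv I g x := by
  ext v
  simp [cderiv, mvfderiv_add hf hg]

theorem cderiv_mul {f g : M → ℂ} {x : M} (hf : MDifferentiableAt I 𝓘(ℝ, ℂ) f x)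
    (hg : MDifferentiableAt I 𝓘(ℝ, ℂ) g x) (η : CTangent I x) :
    cderiv I (f * g) x η = cderiv I f x η * g x + f x * cderiv I g x η := by
  have h : cderiv I (f * g) x = g x • cderiv I f x + f x • cderiv I g x := by
    ext v
    have := (hf.hasMFDerivAt.mul' hg.hasMFDerivAt).mfderiv
    have := congrArg (fun A : TangentSpace I x →L[ℝ] ℂ => A v) this
    simp [cderiv]
    refine this.trans ?_
    change f x * mvfderiv I g x v + mvfderiv I f x v * g x = _
    ring
  rw [h]
  simp
  ring

theorem cderiv_const (c : ℂ) (x : M) : cderiv I (fun _ => c) x = 0 := by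
  ext v
  simp [cderiv, mvfderiv_const]

theorem cderiv_smul (c : ℂ) {f : M → ℂ} {x : M} (hf : MDifferentiableAt I 𝓘(ℝ, ℂ) f x) :
    cderiv I (c • f) x = c • cderiv I f x := by
  ext η
  have h : c • f = (fun _ => c) * f := rfl
  rw [h]
  have := cderiv_mul (mdifferentiableAt_const (c := c)) hf ((1 : ℂ) ⊗ₜ[ℝ] η)
  rw [cderiv_const] at this
  simpa using this

theorem poissonBracket_eq {Ω : DiffForm I M 2} {f g : M → ℂ} {x : M}
    (hΩ : ∀ u : TangentSpace I x, (∀ v, Ω x ![u, v] = 0) → u = 0) {ξ : CTangent I x}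
    (h : ∀ η : CTangent I x, cderiv I f x η = twoForm (Ω x) ξ η) :
    poissonBracket Ω f g x = cderiv I g x ξ := by
  rw [poissonBracket, hamiltonianField_eq hΩ h]

theorem cderiv_comp {E' : Type*} [NormedAddCommGroup E'] [NormedSpace ℝ E']
    {H' : Type*} [TopologicalSpace H'] {I' : ModelWithCorners ℝ E' H'}
    {M' : Type*} [TopologicalSpace M'] [ChartedSpace H' M'] {g : M → ℂ} {f : M' → M} {x : M'}
    (hg : MDifferentiableAt I 𝓘(ℝ, ℂ) g (f x)) (hf : MDifferentiableAt I' I f x)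
    (η : CTangent I' x) :
    cderiv I' (g ∘ f) x η = cderiv I g (f x)
      (LinearMap.baseChange ℂ (mfderiv I' I f x : TangentSpace I' x →ₗ[ℝ] TangentSpace I (f x)) η) := by
  refine linearMap_ext (f := cderiv I' (g ∘ f) x)
    (g := (cderiv I g (f x)).comp (LinearMap.baseChange ℂ
      (mfderiv I' I f x : TangentSpace I' x →ₗ[ℝ] TangentSpace I (f x)))) (fun v => ?_) η
  rw [LinearMap.comp_apply, LinearMap.baseChange_tmul, cderiv_tmul, cderiv_tmul]
  congr 1
  exact mfderiv_comp_apply x hg hf v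

end Poisson

/-! ### Poisson brackets in charts -/

section Flat

variable {E : Type*} [NormedAddCommGroup E] [NormedSpace ℝ E]

variable {A : E → E [⋀^Fin 2]→L[ℝ] ℝ} {y : E}

theorem extDeriv_two_apply (hA : DifferentiableAt ℝ A y) (u v w : E) :
    extDeriv A y ![u, v, w] = fderiv ℝ A y u ![v, w] + fderiv ℝ A y v ![w, u]
      + fderiv ℝ A y w ![u, v] := by
  rw [extDeriv_apply hA]
  refine (Fin.sum_univ_three _).trans ?_
  simp only [fderiv_continuousAlternatingMap_apply_const_apply hA]
  have h0 : (0 : Fin 3).removeNth ![u, v, w] = ![v, w] := by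
    ext i; fin_cases i <;> rfl
  have h1 : (1 : Fin 3).removeNth ![u, v, w] = ![u, w] := by
    ext i; fin_cases i <;> rfl
  have h2 : (2 : Fin 3).removeNth ![u, v, w] = ![u, v] := by
    ext i; fin_cases i <;> rfl
  rw [h0, h1, h2, apply_swap _ u w]
  simp

theorem fderiv_alternating_two_apply {X : E → E} (hA : DifferentiableAt ℝ A y)
    (hX : DifferentiableAt ℝ X y) (v w : E) :
    fderiv ℝ (fun z => A z ![X z, w]) y v
      = fderiv ℝ A y v ![X y, w] + A y ![fderiv ℝ X y v, w] := by
  have h := hA.hasFDerivAt.continuousAlternatingMap_apply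
    (g := ![X, fun _ => w]) (g' := ![fderiv ℝ X y, 0]) (x := y) (by
      intro i; fin_cases i
      · exact hX.hasFDerivAt
      · exact hasFDerivAt_const w y)
  have e : ∀ z, (fun i : Fin 2 => (![X, fun _ => w] : Fin 2 → E → E) i z) = ![X z, w] := by
    intro z; ext i; fin_cases i <;> rfl
  simp only [e] at h
  rw [h.fderiv]
  have e1 : Function.update ![X y, w] 0 (fderiv ℝ X y v) = ![fderiv ℝ X y v, w] := by
    ext i; fin_cases i <;> rfl
  have e2 : Function.update ![X y, w] 1 0 = ![X y, 0] := by
    ext i; fin_cases i <;> rfl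
  simp [Fin.sum_univ_two, e1]

theorem fderiv_fderiv_apply {h : E → ℝ} {Y : E → E} (hh : ContDiffAt ℝ ∞ h y)
    (hY : DifferentiableAt ℝ Y y) (v : E) :
    fderiv ℝ (fun z => fderiv ℝ h z (Y z)) y v
      = fderiv ℝ (fderiv ℝ h) y v (Y y) + fderiv ℝ h y (fderiv ℝ Y y v) := by
  have h2 : DifferentiableAt ℝ (fderiv ℝ h) y :=
    (hh.fderiv_right (m := 1) (by exact WithTop.coe_le_coe.2 le_top)).differentiableAt (by simp)
  rw [(h2.hasFDerivAt.clm_apply hY.hasFDerivAt).fderiv]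
  simp [add_comm]

theorem fderiv_fderiv_of_hamiltonian {f : E → ℝ} {X : E → E} (hA : DifferentiableAt ℝ A y)
    (hf : ContDiffAt ℝ ∞ f y) (hX : DifferentiableAt ℝ X y)
    (hfX : ∀ᶠ z in 𝓝 y, ∀ w, A z ![X z, w] = fderiv ℝ f z w) (v w : E) :
    fderiv ℝ (fderiv ℝ f) y v w = fderiv ℝ A y v ![X y, w] + A y ![fderiv ℝ X y v, w] := by
  have h := fderiv_fderiv_apply hf (differentiableAt_const w) v
  have e : (fun z => A z ![X z, w]) =ᶠ[𝓝 y] fun z => fderiv ℝ f z w := by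
    filter_upwards [hfX] with z hz using hz w
  rw [← e.fderiv_eq, fderiv_alternating_two_apply hA hX] at h
  simpa using h.symm

/-- The Jacobi identity for the Poisson bracket of a closed `2`-form on a vector space. -/
theorem jacobi_of_extDeriv_eq_zero (hA : DifferentiableAt ℝ A y) (hd : extDeriv A y = 0)
    {f g h : E → ℝ} {X Y Z : E → E}
    (hf : ContDiffAt ℝ ∞ f y) (hg : ContDiffAt ℝ ∞ g y) (hh : ContDiffAt ℝ ∞ h y)
    (hX : DifferentiableAt ℝ X y) (hY : DifferentiableAt ℝ Y y) (hZ : DifferentiableAt ℝ Z y)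
    (hfX : ∀ᶠ z in 𝓝 y, ∀ w, A z ![X z, w] = fderiv ℝ f z w)
    (hgY : ∀ᶠ z in 𝓝 y, ∀ w, A z ![Y z, w] = fderiv ℝ g z w)
    (hhZ : ∀ᶠ z in 𝓝 y, ∀ w, A z ![Z z, w] = fderiv ℝ h z w) :
    fderiv ℝ (fun z => fderiv ℝ h z (Y z)) y (X y)
      + fderiv ℝ (fun z => fderiv ℝ f z (Z z)) y (Y y)
      + fderiv ℝ (fun z => fderiv ℝ g z (X z)) y (Z y) = 0 := by
  rw [fderiv_fderiv_apply hh hY, fderiv_fderiv_apply hf hZ, fderiv_fderiv_apply hg hX,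
    ← hfX.self_of_nhds, ← hgY.self_of_nhds, ← hhZ.self_of_nhds,
    apply_swap _ (Z y), apply_swap _ (X y), apply_swap _ (Y y)]
  have hsymm : ∀ {k : E → ℝ}, ContDiffAt ℝ ∞ k y → ∀ u v,
      fderiv ℝ (fderiv ℝ k) y u v = fderiv ℝ (fderiv ℝ k) y v u := fun hk u v =>
    hk.isSymmSndFDerivAt minSmoothness_two_le_infty u v
  have e1 := fderiv_fderiv_of_hamiltonian hA hf hX hfX (Z y) (Y y)
  have e2 := fderiv_fderiv_of_hamiltonian hA hg hY hgY (X y) (Z y)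
  have e3 := fderiv_fderiv_of_hamiltonian hA hh hZ hhZ (Y y) (X y)
  have e4 : extDeriv A y ![X y, Y y, Z y] = 0 := by rw [hd]; rfl
  rw [extDeriv_two_apply hA] at e4
  have s1 := hsymm hf (Z y) (Y y)
  have s2 := hsymm hg (X y) (Z y)
  have s3 := hsymm hh (Y y) (X y)
  have t1 := apply_swap (fderiv ℝ A y (Z y)) (X y) (Y y)
  have t2 := apply_swap (fderiv ℝ A y (X y)) (Y y) (Z y)
  have t3 := apply_swap (fderiv ℝ A y (Y y)) (Z y) (X y)
  linarith

end Flat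

section Chart

variable {E : Type*} [NormedAddCommGroup E] [NormedSpace ℝ E] [FiniteDimensional ℝ E]

/-- A `2`-form on a finite-dimensional space as a map to the dual space. -/
noncomputable def flat (A : E [⋀^Fin 2]→L[ℝ] ℝ) : E →L[ℝ] E →L[ℝ] ℝ :=
  LinearMap.toContinuousLinearMap
    ((LinearMap.toContinuousLinearMap : (E →ₗ[ℝ] ℝ) ≃ₗ[ℝ] E →L[ℝ] ℝ).toLinearMap.comp (bilin A))

@[simp]
theorem flat_apply (A : E [⋀^Fin 2]→L[ℝ] ℝ) (u v : E) : flat A u v = A ![u, v] := rfl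

theorem contDiffOn_flat {A : E → E [⋀^Fin 2]→L[ℝ] ℝ} {s : Set E} (hA : ContDiffOn ℝ ∞ A s) :
    ContDiffOn ℝ ∞ (fun y => flat (A y)) s := by
  rw [contDiffOn_clm_apply]
  intro u
  rw [contDiffOn_clm_apply]
  intro v
  simp only [flat_apply]
  exact (ContinuousAlternatingMap.apply ℝ E ℝ ![u, v]).contDiff.comp_contDiffOn hA

theorem isInvertible_flat {A : E [⋀^Fin 2]→L[ℝ] ℝ} (hA : ∀ u, (∀ v, A ![u, v] = 0) → u = 0) :
    (flat A).IsInvertible := by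
  have hinj : Function.Injective (flat A : E →ₗ[ℝ] E →L[ℝ] ℝ) := by
    rw [injective_iff_map_eq_zero]
    exact fun u hu => hA u fun v => congrArg (fun B : E →L[ℝ] ℝ => B v) hu
  have hrank : Module.finrank ℝ E = Module.finrank ℝ (E →L[ℝ] ℝ) :=
    (Subspace.dual_finrank_eq (K := ℝ) (V := E)).symm.trans
      (LinearMap.toContinuousLinearMap : (E →ₗ[ℝ] ℝ) ≃ₗ[ℝ] E →L[ℝ] ℝ).finrank_eq
  refine ⟨(LinearEquiv.ofInjectiveOfFinrankEq _ hinj hrank).toContinuousLinearEquiv, ?_⟩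
  ext; rfl

end Chart

section Manifold

variable {E : Type*} [NormedAddCommGroup E] [NormedSpace ℝ E]
  {H : Type*} [TopologicalSpace H] {I : ModelWithCorners ℝ E H}
  {M : Type*} [TopologicalSpace M] [ChartedSpace H M]

theorem DiffForm.inChart_apply_two (Ω : DiffForm I M 2) (x : M) (y u v : E) :
    Ω.inChart x y ![u, v] = Ω ((extChartAt I x).symm y)
      ![mfderiv 𝓘(ℝ, E) I (extChartAt I x).symm y u,
        mfderiv 𝓘(ℝ, E) I (extChartAt I x).symm y v] := by
  refine congrArg (Ω ((extChartAt I x).symm y)) ?_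
  ext i; fin_cases i <;> rfl

variable [IsManifold I ∞ M]

theorem contDiffOn_comp_extChartAt_symm {F : Type*} [NormedAddCommGroup F] [NormedSpace ℝ F]
    (x : M) {f : M → F} (hf : ContMDiff I 𝓘(ℝ, F) ∞ f) :
    ContDiffOn ℝ ∞ (f ∘ (extChartAt I x).symm) (extChartAt I x).target :=
  contMDiffOn_iff_contDiffOn.1 (hf.comp_contMDiffOn (contMDiffOn_extChartAt_symm x))

variable [I.Boundaryless]

theorem isInvertible_mfderiv_extChartAt_symm {x : M} {y : E} (hy : y ∈ (extChartAt I x).target) :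
    (mfderiv 𝓘(ℝ, E) I (extChartAt I x).symm y).IsInvertible := by
  have : IsManifold I 1 M := IsManifold.of_le (n := ∞) (by simp)
  have h := isInvertible_mfderivWithin_extChartAt_symm (I := I) hy
  rwa [I.range_eq_univ, mfderivWithin_univ] at h

theorem surjective_mfderiv_extChartAt_symm {x : M} {y : E} (hy : y ∈ (extChartAt I x).target)
    (v : TangentSpace I ((extChartAt I x).symm y)) :
    ∃ w : E, mfderiv 𝓘(ℝ, E) I (extChartAt I x).symm y w = v := by
  obtain ⟨e, he⟩ := isInvertible_mfderiv_extChartAt_symm hy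
  exact ⟨e.symm v, by rw [← he]; exact e.apply_symm_apply v⟩

theorem mvfderiv_ofReal_extChartAt_symm {x : M} {y : E} (hy : y ∈ (extChartAt I x).target)
    {f : M → ℝ} (hf : ContMDiff I 𝓘(ℝ, ℝ) ∞ f) (w : E) :
    mvfderiv I (fun x => (f x : ℂ)) ((extChartAt I x).symm y)
        (mfderiv 𝓘(ℝ, E) I (extChartAt I x).symm y w)
      = (fderiv ℝ (f ∘ (extChartAt I x).symm) y w : ℝ) := by
  have hd : DifferentiableAt ℝ (f ∘ (extChartAt I x).symm) y :=
    ((contDiffOn_comp_extChartAt_symm x hf).contDiffAt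
      (DiffForm.extChartAt_target_mem_nhds_of_mem hy)).differentiableAt (by simp)
  have hc : MDifferentiableAt I 𝓘(ℝ, ℂ) (fun x => (f x : ℂ)) ((extChartAt I x).symm y) :=
    ((Complex.ofRealCLM.contDiff (n := ∞)).contMDiff.comp hf).mdifferentiableAt (by simp)
  have h1 := mfderiv_comp_apply y hc (DiffForm.mdifferentiableAt_extChartAt_symm hy) w
  rw [mfderiv_eq_fderiv] at h1
  refine h1.symm.trans ?_
  have h2 := (Complex.ofRealCLM.hasFDerivAt.comp y hd.hasFDerivAt).fderiv
  exact congrArg (fun B : E →L[ℝ] ℂ => B w) h2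

theorem DiffForm.IsSymplectic.nondegenerate_inChart {Ω : DiffForm I M 2} (hΩ : Ω.IsSymplectic)
    {x : M} {y : E} (hy : y ∈ (extChartAt I x).target) (u : E)
    (hu : ∀ v, Ω.inChart x y ![u, v] = 0) : u = 0 := by
  obtain ⟨e, he⟩ := isInvertible_mfderiv_extChartAt_symm hy
  have h : mfderiv 𝓘(ℝ, E) I (extChartAt I x).symm y u = 0 := by
    refine hΩ.nondegenerate _ _ fun v => ?_
    obtain ⟨w, rfl⟩ := surjective_mfderiv_extChartAt_symm hy v
    exact (DiffForm.inChart_apply_two Ω x y u w).symm.trans (hu w)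
  rw [← he] at h
  exact e.map_eq_zero_iff.1 h

variable [FiniteDimensional ℝ E]

/-- The Hamiltonian vector field of a real function in the chart at `x`. -/
noncomputable def chartField (Ω : DiffForm I M 2) (x : M) (f : M → ℝ) (y : E) : E :=
  (flat (Ω.inChart x y)).inverse (fderiv ℝ (f ∘ (extChartAt I x).symm) y)

namespace DiffForm.IsSymplectic

theorem inChart_chartField {Ω : DiffForm I M 2} (hΩ : Ω.IsSymplectic) {x : M} {y : E}
    (hy : y ∈ (extChartAt I x).target) (f : M → ℝ) (v : E) :
    Ω.inChart x y ![chartField Ω x f y, v] = fderiv ℝ (f ∘ (extChartAt I x).symm) y v := by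
  obtain ⟨e, he⟩ := isInvertible_flat (hΩ.nondegenerate_inChart hy)
  rw [← flat_apply, chartField, ← he, ContinuousLinearMap.inverse_equiv]
  simp

theorem contDiffOn_chartField {Ω : DiffForm I M 2} (hΩ : Ω.IsSymplectic) (x : M) {f : M → ℝ}
    (hf : ContMDiff I 𝓘(ℝ, ℝ) ∞ f) :
    ContDiffOn ℝ ∞ (chartField Ω x f) (extChartAt I x).target := by
  intro y hy
  have : CompleteSpace E := FiniteDimensional.complete ℝ E
  obtain ⟨e, he⟩ := isInvertible_flat (hΩ.nondegenerate_inChart hy)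
  have h1 : ContDiffAt ℝ ∞ ContinuousLinearMap.inverse (flat (Ω.inChart x y)) :=
    he ▸ contDiffAt_map_inverse e
  have h2 := h1.comp_contDiffWithinAt y (contDiffOn_flat (hΩ.smooth x) y hy)
  exact h2.clm_apply ((contDiffOn_comp_extChartAt_symm x hf).fderiv_of_isOpen (m := ∞)
    (isOpen_extChartAt_target x) (by simp) y hy)

theorem poissonBracket_ofReal {Ω : DiffForm I M 2} (hΩ : Ω.IsSymplectic) {x : M} {y : E}
    (hy : y ∈ (extChartAt I x).target) {f g : M → ℝ}
    (hf : ContMDiff I 𝓘(ℝ, ℝ) ∞ f) (hg : ContMDiff I 𝓘(ℝ, ℝ) ∞ g) :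
    poissonBracket Ω (fun x => (f x : ℂ)) (fun x => (g x : ℂ)) ((extChartAt I x).symm y)
      = (fderiv ℝ (g ∘ (extChartAt I x).symm) y (chartField Ω x f y) : ℝ) := by
  rw [poissonBracket_eq (hΩ.nondegenerate _) (ξ := (1 : ℂ) ⊗ₜ[ℝ]
    mfderiv 𝓘(ℝ, E) I (extChartAt I x).symm y (chartField (E := E) Ω x f y)),
    cderiv_tmul, mvfderiv_ofReal_extChartAt_symm hy hg, one_mul]
  refine linearMap_ext fun v => ?_
  obtain ⟨w, rfl⟩ := surjective_mfderiv_extChartAt_symm hy v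
  rw [cderiv_tmul, twoForm_tmul, mvfderiv_ofReal_extChartAt_symm hy hf,
    ← DiffForm.inChart_apply_two, hΩ.inChart_chartField hy]
  simp

/-- The Poisson bracket of real functions is real and smooth. -/
theorem exists_real_bracket {Ω : DiffForm I M 2} (hΩ : Ω.IsSymplectic) {f g : M → ℝ}
    (hf : ContMDiff I 𝓘(ℝ, ℝ) ∞ f) (hg : ContMDiff I 𝓘(ℝ, ℝ) ∞ g) :
    ∃ b : M → ℝ, ContMDiff I 𝓘(ℝ, ℝ) ∞ b ∧
      poissonBracket Ω (fun x => (f x : ℂ)) (fun x => (g x : ℂ)) = (fun x => (b x : ℂ)) ∧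
      ∀ (x : M), ∀ y ∈ (extChartAt I x).target,
        b ((extChartAt I x).symm y)
          = fderiv ℝ (g ∘ (extChartAt I x).symm) y (chartField Ω x f y) := by
  have key : ∀ (x : M), ∀ y ∈ (extChartAt I x).target,
      (poissonBracket Ω (fun x => (f x : ℂ)) (fun x => (g x : ℂ)) ((extChartAt I x).symm y)).re
        = fderiv ℝ (g ∘ (extChartAt I x).symm) y (chartField Ω x f y) := fun x y hy => by
    rw [hΩ.poissonBracket_ofReal hy hf hg, Complex.ofReal_re]
  refine ⟨fun x => (poissonBracket Ω (fun x => (f x : ℂ)) (fun x => (g x : ℂ)) x).re,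
    fun x => ?_, funext fun x => ?_, key⟩
  · have h1 : ContDiffOn ℝ ∞ (fun y => fderiv ℝ (g ∘ (extChartAt I x).symm) y
        (chartField Ω x f y)) (extChartAt I x).target :=
      ((contDiffOn_comp_extChartAt_symm x hg).fderiv_of_isOpen (m := ∞)
        (isOpen_extChartAt_target x) (by simp)).clm_apply (hΩ.contDiffOn_chartField x hf)
    have h2 : ContMDiffAt 𝓘(ℝ, E) 𝓘(ℝ, ℝ) ∞ (fun y => fderiv ℝ (g ∘ (extChartAt I x).symm) y
        (chartField Ω x f y)) (extChartAt I x x) :=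
      (h1.contDiffAt (extChartAt_target_mem_nhds x)).contMDiffAt
    refine (h2.comp x (contMDiffAt_extChartAt (n := ∞))).congr_of_eventuallyEq ?_
    filter_upwards [extChartAt_source_mem_nhds (I := I) x] with z hz
    rw [Function.comp_apply, ← key x _ ((extChartAt I x).map_source hz),
      (extChartAt I x).left_inv hz]
  · have h := hΩ.poissonBracket_ofReal (mem_extChartAt_target (I := I) x) hf hg
    rw [extChartAt_to_inv] at h
    simp only [h, Complex.ofReal_re]

theorem jacobi_ofReal {Ω : DiffForm I M 2} (hΩ : Ω.IsSymplectic) {f g h : M → ℝ}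
    (hf : ContMDiff I 𝓘(ℝ, ℝ) ∞ f) (hg : ContMDiff I 𝓘(ℝ, ℝ) ∞ g)
    (hh : ContMDiff I 𝓘(ℝ, ℝ) ∞ h) :
    poissonBracket Ω (fun x => (f x : ℂ))
        (poissonBracket Ω (fun x => (g x : ℂ)) (fun x => (h x : ℂ)))
      + poissonBracket Ω (fun x => (g x : ℂ))
        (poissonBracket Ω (fun x => (h x : ℂ)) (fun x => (f x : ℂ)))
      + poissonBracket Ω (fun x => (h x : ℂ))
        (poissonBracket Ω (fun x => (f x : ℂ)) (fun x => (g x : ℂ))) = 0 := by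
  obtain ⟨gh, hgh, egh, cgh⟩ := hΩ.exists_real_bracket hg hh
  obtain ⟨hf', hhf, ehf, chf⟩ := hΩ.exists_real_bracket hh hf
  obtain ⟨fg, hfg, efg, cfg⟩ := hΩ.exists_real_bracket hf hg
  obtain ⟨b1, -, e1, c1⟩ := hΩ.exists_real_bracket hf hgh
  obtain ⟨b2, -, e2, c2⟩ := hΩ.exists_real_bracket hg hhf
  obtain ⟨b3, -, e3, c3⟩ := hΩ.exists_real_bracket hh hfg
  rw [egh, ehf, efg, e1, e2, e3]
  ext x
  have hx := mem_extChartAt_target (I := I) x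
  have hxn := extChartAt_target_mem_nhds (I := I) x
  have e : ∀ {b : M → ℝ} {B : E → ℝ}, (∀ y ∈ (extChartAt I x).target,
      b ((extChartAt I x).symm y) = B y) →
      fderiv ℝ (b ∘ (extChartAt I x).symm) (extChartAt I x x) = fderiv ℝ B (extChartAt I x x) :=
    fun hb => Filter.EventuallyEq.fderiv_eq (by filter_upwards [hxn] with y hy using hb y hy)
  have a1 := c1 x _ hx
  have a2 := c2 x _ hx
  have a3 := c3 x _ hx
  rw [extChartAt_to_inv] at a1 a2 a3
  rw [e (cgh x)] at a1
  rw [e (chf x)] at a2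
  rw [e (cfg x)] at a3
  have hs : ∀ {k : M → ℝ}, ContMDiff I 𝓘(ℝ, ℝ) ∞ k →
      ContDiffAt ℝ ∞ (k ∘ (extChartAt I x).symm) (extChartAt I x x) := fun hk =>
    (contDiffOn_comp_extChartAt_symm x hk).contDiffAt hxn
  have hX : ∀ {k : M → ℝ}, ContMDiff I 𝓘(ℝ, ℝ) ∞ k →
      DifferentiableAt ℝ (chartField Ω x k) (extChartAt I x x) := fun hk =>
    ((hΩ.contDiffOn_chartField x hk).contDiffAt hxn).differentiableAt (by simp)
  have hH : ∀ k : M → ℝ, ∀ᶠ z in 𝓝 (extChartAt I x x), ∀ w,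
      Ω.inChart x z ![chartField Ω x k z, w] = fderiv ℝ (k ∘ (extChartAt I x).symm) z w :=
    fun k => by filter_upwards [hxn] with z hz using hΩ.inChart_chartField hz k
  have hd : extDeriv (Ω.inChart x) (extChartAt I x x) = 0 :=
    (DiffForm.d_eq_extDeriv Ω x).symm.trans (hΩ.closed x)
  have key := jacobi_of_extDeriv_eq_zero
    ((hΩ.smooth.contDiffAt_inChart hx).differentiableAt (by simp)) hd
    (hs hf) (hs hg) (hs hh) (hX hf) (hX hg) (hX hh) (hH f) (hH g) (hH h)
  rw [← a1, ← a2, ← a3] at key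
  simp only [Pi.add_apply, Pi.zero_apply]
  exact_mod_cast key

end DiffForm.IsSymplectic

end Manifold

/-! ### The Poisson Lie algebra of a symplectic manifold -/

section SmoothFun

variable {E : Type*} [NormedAddCommGroup E] [NormedSpace ℝ E]
  {H : Type*} [TopologicalSpace H] {I : ModelWithCorners ℝ E H}
  {M : Type*} [TopologicalSpace M] [ChartedSpace H M]

namespace IsSmoothFun

variable {f g : M → ℂ}

theorem mdifferentiableAt (hf : IsSmoothFun I f) (x : M) : MDifferentiableAt I 𝓘(ℝ, ℂ) f x :=
  ContMDiffAt.mdifferentiableAt (hf x) (by simp)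

theorem add (hf : IsSmoothFun I f) (hg : IsSmoothFun I g) : IsSmoothFun I (f + g) :=
  ContMDiff.add hf hg

theorem const_smul (c : ℂ) (hf : IsSmoothFun I f) : IsSmoothFun I (c • f) :=
  (ContinuousLinearMap.contDiff (c • ContinuousLinearMap.id ℝ ℂ)).contMDiff.comp hf

theorem mul (hf : IsSmoothFun I f) (hg : IsSmoothFun I g) : IsSmoothFun I (f * g) :=
  (contDiff_mul (𝕜 := ℝ) (𝔸 := ℂ) (n := ∞)).contMDiff.comp (ContMDiff.prodMk_space hf hg)

theorem ofReal {f : M → ℝ} (hf : ContMDiff I 𝓘(ℝ, ℝ) ∞ f) :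
    IsSmoothFun I (fun x => (f x : ℂ)) :=
  (Complex.ofRealCLM.contDiff (n := ∞)).contMDiff.comp hf

/-- Smooth complex functions are generated by smooth real functions. -/
theorem induction {p : (M → ℂ) → Prop}
    (ofReal : ∀ f : M → ℝ, ContMDiff I 𝓘(ℝ, ℝ) ∞ f → p fun x => (f x : ℂ))
    (add : ∀ f g, IsSmoothFun I f → IsSmoothFun I g → p f → p g → p (f + g))
    (smul : ∀ (c : ℂ) f, IsSmoothFun I f → p f → p (c • f)) (hf : IsSmoothFun I f) : p f := by
  have hre : ContMDiff I 𝓘(ℝ, ℝ) ∞ fun x => (f x).re :=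
    (Complex.reCLM.contDiff (n := ∞)).contMDiff.comp hf
  have him : ContMDiff I 𝓘(ℝ, ℝ) ∞ fun x => (f x).im :=
    (Complex.imCLM.contDiff (n := ∞)).contMDiff.comp hf
  have e : f = (fun x => ((f x).re : ℂ)) + Complex.I • fun x => ((f x).im : ℂ) := by
    ext x
    simpa [mul_comm] using (Complex.re_add_im (f x)).symm
  rw [e]
  exact add _ _ (IsSmoothFun.ofReal hre) (.const_smul _ (IsSmoothFun.ofReal him)) (ofReal _ hre)
    (smul _ _ (IsSmoothFun.ofReal him) (ofReal _ him))

end IsSmoothFun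

namespace DiffForm.IsSymplectic

variable {Ω : DiffForm I M 2} {f f' g g' h : M → ℂ}

theorem poissonBracket_add_right (hg : IsSmoothFun I g) (hg' : IsSmoothFun I g') :
    poissonBracket Ω f (g + g') = poissonBracket Ω f g + poissonBracket Ω f g' := by
  ext x
  simp [poissonBracket, cderiv_add (hg.mdifferentiableAt x) (hg'.mdifferentiableAt x)]

theorem poissonBracket_smul_right (c : ℂ) (hg : IsSmoothFun I g) :
    poissonBracket Ω f (c • g) = c • poissonBracket Ω f g := by
  ext x
  simp [poissonBracket, cderiv_smul c (hg.mdifferentiableAt x)]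

theorem poissonBracket_mul_right (hg : IsSmoothFun I g) (hh : IsSmoothFun I h) :
    poissonBracket Ω f (g * h) = poissonBracket Ω f g * h + g * poissonBracket Ω f h := by
  ext x
  exact cderiv_mul (hg.mdifferentiableAt x) (hh.mdifferentiableAt x) _

variable [FiniteDimensional ℝ E]

theorem poissonBracket_add_left (hΩ : Ω.IsSymplectic) (hf : IsSmoothFun I f)
    (hf' : IsSmoothFun I f') :
    poissonBracket Ω (f + f') g = poissonBracket Ω f g + poissonBracket Ω f' g := by
  ext x
  rw [poissonBracket_eq (hΩ.nondegenerate x)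
    (ξ := hamiltonianField Ω f x + hamiltonianField Ω f' x), map_add]
  · rfl
  · intro η
    rw [cderiv_add (hf.mdifferentiableAt x) (hf'.mdifferentiableAt x), map_add,
      LinearMap.add_apply, LinearMap.add_apply, hamiltonianField_spec (hΩ.nondegenerate x),
      hamiltonianField_spec (hΩ.nondegenerate x)]

theorem poissonBracket_smul_left (hΩ : Ω.IsSymplectic) (c : ℂ) (hf : IsSmoothFun I f) :
    poissonBracket Ω (c • f) g = c • poissonBracket Ω f g := by
  ext x
  rw [poissonBracket_eq (hΩ.nondegenerate x) (ξ := c • hamiltonianField Ω f x), map_smul]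
  · rfl
  · intro η
    rw [cderiv_smul c (hf.mdifferentiableAt x), map_smul, LinearMap.smul_apply,
      LinearMap.smul_apply, hamiltonianField_spec (hΩ.nondegenerate x)]

theorem poissonBracket_self (hΩ : Ω.IsSymplectic) : poissonBracket Ω f f = 0 := by
  ext x
  rw [poissonBracket, hamiltonianField_spec (hΩ.nondegenerate x), twoForm_self]
  rfl

variable [I.Boundaryless] [IsManifold I ∞ M]

theorem smooth_poissonBracket (hΩ : Ω.IsSymplectic) (hf : IsSmoothFun I f)
    (hg : IsSmoothFun I g) : IsSmoothFun I (poissonBracket Ω f g) := by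
  refine hf.induction (p := fun f => IsSmoothFun I (poissonBracket Ω f g)) (fun f hf => ?_)
    (fun f f' hf hf' h h' => ?_) (fun c f hf h => ?_)
  · refine hg.induction (p := fun g => IsSmoothFun I (poissonBracket Ω _ g)) (fun g hg => ?_)
      (fun g g' hg hg' h h' => ?_) (fun c g hg h => ?_)
    · obtain ⟨b, hb, e, -⟩ := hΩ.exists_real_bracket hf hg
      rw [e]
      exact .ofReal hb
    · rw [poissonBracket_add_right hg hg']
      exact h.add h'
    · rw [poissonBracket_smul_right c hg]
      exact h.const_smul c
  · rw [hΩ.poissonBracket_add_left hf hf']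
    exact h.add h'
  · rw [hΩ.poissonBracket_smul_left c hf]
    exact h.const_smul c

/-- The Jacobi identity is inherited by sums and multiples in its first argument. -/
theorem jacobi_of_ofReal (hΩ : Ω.IsSymplectic) (hg : IsSmoothFun I g) (hh : IsSmoothFun I h)
    (H : ∀ f : M → ℝ, ContMDiff I 𝓘(ℝ, ℝ) ∞ f →
      poissonBracket Ω (fun x => (f x : ℂ)) (poissonBracket Ω g h)
        + poissonBracket Ω g (poissonBracket Ω h (fun x => (f x : ℂ)))
        + poissonBracket Ω h (poissonBracket Ω (fun x => (f x : ℂ)) g) = 0)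
    (hf : IsSmoothFun I f) :
    poissonBracket Ω f (poissonBracket Ω g h) + poissonBracket Ω g (poissonBracket Ω h f)
      + poissonBracket Ω h (poissonBracket Ω f g) = 0 := by
  refine hf.induction (p := fun f => poissonBracket Ω f (poissonBracket Ω g h)
    + poissonBracket Ω g (poissonBracket Ω h f) + poissonBracket Ω h (poissonBracket Ω f g) = 0) H
    (fun f f' hf hf' h1 h2 => ?_) (fun c f hf h1 => ?_)
  · rw [hΩ.poissonBracket_add_left hf hf', hΩ.poissonBracket_add_left hf hf',
      poissonBracket_add_right hf hf',
      poissonBracket_add_right (hΩ.smooth_poissonBracket hh hf) (hΩ.smooth_poissonBracket hh hf'),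
      poissonBracket_add_right (hΩ.smooth_poissonBracket hf hg) (hΩ.smooth_poissonBracket hf' hg)]
    linear_combination h1 + h2
  · rw [hΩ.poissonBracket_smul_left c hf, hΩ.poissonBracket_smul_left c hf,
      poissonBracket_smul_right c hf,
      poissonBracket_smul_right c (hΩ.smooth_poissonBracket hh hf),
      poissonBracket_smul_right c (hΩ.smooth_poissonBracket hf hg), ← smul_add, ← smul_add, h1,
      smul_zero]

/-- The smooth functions on a symplectic manifold form a Poisson Lie algebra. -/
theorem isPoissonLieAlgebra (hΩ : Ω.IsSymplectic) : IsPoissonLieAlgebra Ω where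
  smooth _ _ hf hg := hΩ.smooth_poissonBracket hf hg
  add_left _ _ _ hf hg _ := hΩ.poissonBracket_add_left hf hg
  smul_left c _ _ hf _ := hΩ.poissonBracket_smul_left c hf
  add_right _ _ _ _ hg hh := poissonBracket_add_right hg hh
  smul_right c _ _ _ hg := poissonBracket_smul_right c hg
  self _ _ := hΩ.poissonBracket_self
  leibniz _ _ _ _ hg hh := poissonBracket_mul_right hg hh
  jacobi f g h hf hg hh := by
    refine hΩ.jacobi_of_ofReal hg hh (fun f hf => ?_) hf
    rw [add_assoc, add_comm]
    refine hΩ.jacobi_of_ofReal hh (.ofReal hf) (fun g hg => ?_) hg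
    rw [add_assoc, add_comm]
    refine hΩ.jacobi_of_ofReal (.ofReal hf) (.ofReal hg) (fun h hh => ?_) hh
    exact hΩ.jacobi_ofReal hh hf hg

end DiffForm.IsSymplectic

end SmoothFun

/-! ### Geometry of the circle bundle -/

section LineBundle

variable {E : Type*} [NormedAddCommGroup E] [NormedSpace ℝ E]
  {H : Type*} [TopologicalSpace H] {I : ModelWithCorners ℝ E H}
  {X : Type*} [TopologicalSpace X] [ChartedSpace H X]
  {L : X → Type*} [TopologicalSpace (TotalSpace ℂ L)]
  [∀ x, NormedAddCommGroup (L x)] [∀ x, InnerProductSpace ℂ (L x)]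
  [FiberBundle ℂ L] [VectorBundle ℂ ℂ L]

namespace LineBundle

/-- The fibers are complex lines. -/
theorem exists_eq_smul {x : X} {v : L x} (hv : v ≠ 0) (w : L x) : ∃ c : ℂ, w = c • v := by
  let ψ := (trivializationAt ℂ L x).continuousLinearEquivAt ℂ x
    (mem_baseSet_trivializationAt ℂ L x)
  have hne : ψ v ≠ 0 := fun h => hv (ψ.map_eq_zero_iff.1 h)
  refine ⟨ψ w / ψ v, ψ.injective ?_⟩
  rw [map_smul, smul_eq_mul, div_mul_cancel₀ _ hne]

theorem inner_smul_self {x : X} {v : L x} (hv : ‖v‖ = 1) (w : L x) : inner ℂ v w • v = w := by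
  have hne : v ≠ 0 := fun h => by simp [h] at hv
  obtain ⟨c, rfl⟩ := exists_eq_smul hne w
  rw [inner_smul_right, inner_self_eq_norm_sq_to_K, hv]
  simp

theorem trivialization_smul {x₀ x : X} (hx : x ∈ (trivializationAt ℂ L x₀).baseSet) (c : ℂ)
    (v : L x) :
    (trivializationAt ℂ L x₀ ⟨x, c • v⟩).2 = c * (trivializationAt ℂ L x₀ ⟨x, v⟩).2 := by
  exact ((trivializationAt ℂ L x₀).linear ℂ hx).map_smul c v

variable {E' : Type*} [NormedAddCommGroup E'] [NormedSpace ℝ E']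
  {H' : Type*} [TopologicalSpace H'] {I' : ModelWithCorners ℝ E' H'}
  {N : Type*} [TopologicalSpace N] [ChartedSpace H' N]

/-- Multiplication by smooth functions preserves smoothness of maps to the total space. -/
theorem contMDiffAt_smul {c : N → ℂ} {f : N → TotalSpace ℂ L} {n : N}
    (hc : ContMDiffAt I' 𝓘(ℝ, ℂ) ∞ c n) (hf : ContMDiffAt I' (I.prod 𝓘(ℝ, ℂ)) ∞ f n) :
    ContMDiffAt I' (I.prod 𝓘(ℝ, ℂ)) ∞
      (fun m => (⟨(f m).1, c m • (f m).2⟩ : TotalSpace ℂ L)) n := by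
  rw [contMDiffAt_totalSpace] at hf ⊢
  refine ⟨hf.1, ?_⟩
  have h : ∀ᶠ m in 𝓝 n, (f m).1 ∈ (trivializationAt ℂ L (f n).1).baseSet :=
    hf.1.continuousAt.preimage_mem_nhds
      ((trivializationAt ℂ L (f n).1).open_baseSet.mem_nhds (mem_baseSet_trivializationAt ℂ L _))
  have hmul : ContMDiffAt I' 𝓘(ℝ, ℂ) ∞
      (fun m => c m * (trivializationAt ℂ L (f n).1 (f m)).2) n :=
    ((contDiff_mul (𝕜 := ℝ) (𝔸 := ℂ) (n := ∞)).contMDiff.contMDiffAt).comp n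
      (hc.prodMk_space hf.2)
  refine hmul.congr_of_eventuallyEq ?_
  filter_upwards [h] with m hm
  exact trivialization_smul hm _ _

variable [VectorBundle ℝ ℂ L] [ContMDiffVectorBundle ∞ ℂ L I]

/-- Around every point there is a smooth nowhere zero section. -/
theorem exists_local_frame (x₀ : X) : ∃ (U : Set X) (t : Π x, L x), IsOpen U ∧ x₀ ∈ U ∧
    IsSmoothSectionOn I t U ∧ ∀ x ∈ U, t x ≠ 0 := by
  classical
  let e := trivializationAt ℂ L x₀
  let t : Π x, L x := fun x => if hx : x ∈ e.baseSet then
    (e.continuousLinearEquivAt ℂ x hx).symm 1 else 0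
  have ht : ∀ x ∈ e.baseSet, (e ⟨x, t x⟩).2 = 1 := fun x hx => by
    have : t x = (e.continuousLinearEquivAt ℂ x hx).symm 1 := dif_pos hx
    rw [this]
    exact (congrArg Prod.snd (e.apply_eq_prod_continuousLinearEquivAt ℂ x hx _)).trans
      ((e.continuousLinearEquivAt ℂ x hx).apply_symm_apply 1)
  refine ⟨e.baseSet, t, e.open_baseSet, mem_baseSet_trivializationAt ℂ L x₀, ?_, fun x hx h => ?_⟩
  · refine (e.contMDiffOn_section_baseSet_iff (IB := I)).2 ?_
    exact contMDiffOn_const.congr ht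
  · have h1 := (congrArg Prod.snd (e.apply_eq_prod_continuousLinearEquivAt ℂ x hx (t x))).symm
    rw [ht x hx, h] at h1
    exact zero_ne_one ((e.continuousLinearEquivAt ℂ x hx).map_zero.symm.trans h1)

/-- Around every point there is a smooth section of norm one. -/
theorem exists_local_unit_section (hL : IsSmoothHermitian I L) (q : CircleBundle L) :
    ∃ (U : Set X) (s : Π x, L x), IsOpen U ∧ q.1.1 ∈ U ∧
      IsSmoothSectionOn I s U ∧ (∀ x ∈ U, ‖s x‖ = 1) ∧ s q.1.1 = q.1.2 := by
  obtain ⟨U, t, hU, hx₀, ht, hne⟩ := exists_local_frame (I := I) (L := L) q.1.1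
  obtain ⟨c, hc⟩ := exists_eq_smul (hne _ hx₀) q.1.2
  let k : X → ℂ := fun x => c * ((‖t q.1.1‖ / ‖t x‖ : ℝ) : ℂ)
  have hpos : ∀ x ∈ U, 0 < ‖t x‖ := fun x hx => norm_pos_iff.2 (hne x hx)
  have hk : ContMDiffOn I 𝓘(ℝ, ℂ) ∞ k U := by
    intro x hx
    have h1 : ContMDiffAt I 𝓘(ℝ, ℂ) ∞ (fun x => inner ℂ (t x) (t x)) x :=
      (hL U t t hU ht ht).contMDiffAt (hU.mem_nhds hx)
    have e : ∀ x, inner ℂ (t x) (t x) = ((‖t x‖ ^ 2 : ℝ) : ℂ) := fun x => by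
      rw [inner_self_eq_norm_sq_to_K]; norm_cast
    let F : ℂ → ℂ := fun z => c * ((‖t q.1.1‖ / Real.sqrt z.re : ℝ) : ℂ)
    have hF : ContDiffAt ℝ ∞ F (inner ℂ (t x) (t x)) := by
      have hre : (inner ℂ (t x) (t x)).re = ‖t x‖ ^ 2 := by rw [e, Complex.ofReal_re]
      have h0 : (inner ℂ (t x) (t x)).re ≠ 0 := by
        rw [hre]; exact pow_ne_zero 2 (hpos x hx).ne'
      have h2 : Real.sqrt (inner ℂ (t x) (t x)).re ≠ 0 := by
        rw [hre, Real.sqrt_sq (hpos x hx).le]; exact (hpos x hx).ne'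
      exact contDiffAt_const.mul (Complex.ofRealCLM.contDiff.contDiffAt.comp _
        (contDiffAt_const.div (Complex.reCLM.contDiff.contDiffAt.sqrt h0) h2))
    refine ((hF.contMDiffAt.comp x h1).congr_of_eventuallyEq ?_).contMDiffWithinAt
    filter_upwards with y
    simp only [k, F, Function.comp_apply, e, Complex.ofReal_re, Real.sqrt_sq (norm_nonneg _)]
  refine ⟨U, fun x => k x • t x, hU, hx₀, fun x hx => ?_, fun x hx => ?_, ?_⟩
  · exact (contMDiffAt_smul (hk.contMDiffAt (hU.mem_nhds hx))
      (ht.contMDiffAt (hU.mem_nhds hx))).contMDiffWithinAt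
  · have h1 : ‖c‖ * ‖t q.1.1‖ = 1 := by rw [← norm_smul, ← hc]; exact q.2
    have h2 := (hpos x hx).ne'
    simp only [k, norm_smul, norm_mul, Complex.norm_real, norm_div, norm_norm]
    rw [mul_assoc, div_mul_cancel₀ _ h2, h1]
  · have h2 := (hpos _ hx₀).ne'
    simp only [k]
    rw [div_self h2, Complex.ofReal_one, mul_one, hc]

end LineBundle

end LineBundle

section CircleBundleGeometry

variable {E : Type*} [NormedAddCommGroup E] [NormedSpace ℝ E]
  {H : Type*} [TopologicalSpace H] {I : ModelWithCorners ℝ E H}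
  {X : Type*} [TopologicalSpace X] [ChartedSpace H X] [IsManifold I ∞ X]
  {L : X → Type*} [TopologicalSpace (TotalSpace ℂ L)]
  [∀ x, NormedAddCommGroup (L x)] [∀ x, InnerProductSpace ℂ (L x)]
  [FiberBundle ℂ L] [VectorBundle ℝ ℂ L] [VectorBundle ℂ ℂ L] [ContMDiffVectorBundle ∞ ℂ L I]
  {E₁ : Type*} [NormedAddCommGroup E₁] [NormedSpace ℝ E₁]
  {H₁ : Type*} [TopologicalSpace H₁] {J : ModelWithCorners ℝ E₁ H₁}
  [ChartedSpace H₁ (CircleBundle L)] [IsManifold J ∞ (CircleBundle L)]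
  {E' : Type*} [NormedAddCommGroup E'] [NormedSpace ℝ E']
  {H' : Type*} [TopologicalSpace H'] {I' : ModelWithCorners ℝ E' H'}
  {N : Type*} [TopologicalSpace N] [ChartedSpace H' N]

namespace CircleBundle

theorem smul_val (c : Circle) (q : CircleBundle L) :
    (c • q).1 = (⟨q.1.1, (c : ℂ) • q.1.2⟩ : TotalSpace ℂ L) := rfl

theorem exp_zero_smul (q : CircleBundle L) : Circle.exp 0 • q = q := by
  refine Subtype.ext ?_
  rw [smul_val, Circle.exp_zero, Circle.coe_one, one_smul]

theorem contMDiff_τ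
    (hL₁ : Manifold.IsSmoothEmbedding J (I.prod 𝓘(ℝ, ℂ)) ∞
      (Subtype.val : CircleBundle L → TotalSpace ℂ L)) :
    ContMDiff J I ∞ (τ : CircleBundle L → X) :=
  (contMDiff_proj L).comp hL₁.contMDiff

/-- Smoothness of maps to the circle bundle is smoothness as maps to the line bundle. -/
theorem contMDiffAt_of_val
    (hL₁ : Manifold.IsSmoothEmbedding J (I.prod 𝓘(ℝ, ℂ)) ∞
      (Subtype.val : CircleBundle L → TotalSpace ℂ L))
    [IsManifold I' ∞ N] {f : N → CircleBundle L} {n : N}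
    (hf : ContMDiffAt I' (I.prod 𝓘(ℝ, ℂ)) ∞ (fun m => (f m).1) n) : ContMDiffAt I' J ∞ f n :=
  (ContMDiffAt.iff_comp_isImmersionAt (hL₁.isImmersion.isImmersionAt (f n))).2
    ⟨hL₁.isEmbedding.isInducing.continuousAt_iff.2 hf.continuousAt, hf⟩

theorem contDiff_circleExp : ContDiff ℝ ∞ fun t : ℝ => (Circle.exp t : ℂ) := by
  simp only [Circle.coe_exp]
  exact (Complex.ofRealCLM.contDiff.mul contDiff_const).cexp

theorem contMDiffAt_exp_smul
    (hL₁ : Manifold.IsSmoothEmbedding J (I.prod 𝓘(ℝ, ℂ)) ∞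
      (Subtype.val : CircleBundle L → TotalSpace ℂ L))
    [IsManifold I' ∞ N] {a : N → ℝ} {f : N → CircleBundle L} {n : N}
    (ha : ContMDiffAt I' 𝓘(ℝ, ℝ) ∞ a n) (hf : ContMDiffAt I' J ∞ f n) :
    ContMDiffAt I' J ∞ (fun m => Circle.exp (a m) • f m) n :=
  contMDiffAt_of_val hL₁ (LineBundle.contMDiffAt_smul
    (contDiff_circleExp.contMDiff.contMDiffAt.comp n ha) (hL₁.contMDiff.contMDiffAt.comp n hf))

/-- A smooth local section of the circle bundle through a given point. -/
structure IsLocalSection (J : ModelWithCorners ℝ E₁ H₁) (I : ModelWithCorners ℝ E H)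
    [ChartedSpace H X] [ChartedSpace H₁ (CircleBundle L)] (q : CircleBundle L) (U : Set X)
    (s : Π x, L x) (σ : X → CircleBundle L) : Prop where
  isOpen : IsOpen U
  mem : τ q ∈ U
  smooth_section : IsSmoothSectionOn I s U
  smooth : ContMDiffOn I J ∞ σ U
  val : ∀ x ∈ U, (σ x).1 = ⟨x, s x⟩
  apply_self : σ (τ q) = q

theorem exists_isLocalSection (hL : IsSmoothHermitian I L)
    (hL₁ : Manifold.IsSmoothEmbedding J (I.prod 𝓘(ℝ, ℂ)) ∞
      (Subtype.val : CircleBundle L → TotalSpace ℂ L)) (q : CircleBundle L) :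
    ∃ (U : Set X) (s : Π x, L x) (σ : X → CircleBundle L), IsLocalSection J I q U s σ := by
  classical
  obtain ⟨U, s, hU, hq, hs, hn, hsq⟩ := LineBundle.exists_local_unit_section hL q
  let σ : X → CircleBundle L := fun x => if hx : x ∈ U then ⟨⟨x, s x⟩, hn x hx⟩ else q
  have hσ : ∀ x ∈ U, (σ x).1 = ⟨x, s x⟩ := fun x hx => by simp only [σ, dif_pos hx]
  refine ⟨U, s, σ, hU, hq, hs, fun x hx => ?_, hσ, ?_⟩
  · refine (contMDiffAt_of_val hL₁ ?_).contMDiffWithinAt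
    refine (hs.contMDiffAt (hU.mem_nhds hx)).congr_of_eventuallyEq ?_
    filter_upwards [hU.mem_nhds hx] with y hy using hσ y hy
  · refine Subtype.ext ((hσ _ hq).trans ?_)
    change (⟨q.1.1, s q.1.1⟩ : TotalSpace ℂ L) = q.1
    rw [hsq]

namespace IsLocalSection

variable {q : CircleBundle L} {U : Set X} {s : Π x, L x} {σ : X → CircleBundle L}

theorem τ_apply (hσ : IsLocalSection J I q U s σ) {x : X} (hx : x ∈ U) : τ (σ x) = x := by
  rw [τ, hσ.val x hx]

theorem norm_eq_one (hσ : IsLocalSection J I q U s σ) {x : X} (hx : x ∈ U) : ‖s x‖ = 1 := by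
  have h := (σ x).2
  rw [hσ.val x hx] at h
  exact h

theorem tildeSection_apply (hσ : IsLocalSection J I q U s σ) {x : X} (hx : x ∈ U)
    (t : Π x, L x) : tildeSection t (σ x) = inner ℂ (s x) (t x) := by
  rw [tildeSection, hσ.val x hx]

theorem contMDiffAt (hσ : IsLocalSection J I q U s σ) : ContMDiffAt I J ∞ σ (τ q) :=
  hσ.smooth.contMDiffAt (hσ.isOpen.mem_nhds hσ.mem)

theorem eventually_mem (hσ : IsLocalSection J I q U s σ)
    (hL₁ : Manifold.IsSmoothEmbedding J (I.prod 𝓘(ℝ, ℂ)) ∞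
      (Subtype.val : CircleBundle L → TotalSpace ℂ L)) : ∀ᶠ q' in 𝓝 q, τ q' ∈ U :=
  (contMDiff_τ hL₁).continuous.continuousAt.preimage_mem_nhds (hσ.isOpen.mem_nhds hσ.mem)

/-- The angle relative to a local section. -/
theorem exists_angle (hσ : IsLocalSection J I q U s σ)
    (hL₁ : Manifold.IsSmoothEmbedding J (I.prod 𝓘(ℝ, ℂ)) ∞
      (Subtype.val : CircleBundle L → TotalSpace ℂ L)) :
    ∃ θ : CircleBundle L → ℝ, ContMDiffAt J 𝓘(ℝ, ℝ) ∞ θ q ∧ θ q = 0 ∧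
      ∀ᶠ q' in 𝓝 q, Circle.exp (θ q') • σ (τ q') = q' := by
  let e := trivializationAt ℂ L (τ q)
  let c : CircleBundle L → ℂ := fun q' => (e q'.1).2 / (e (σ (τ q')).1).2
  have hτ := (contMDiff_τ hL₁).contMDiffAt (x := q)
  have hmem : ∀ᶠ q' in 𝓝 q, τ q' ∈ e.baseSet := hτ.continuousAt.preimage_mem_nhds
    (e.open_baseSet.mem_nhds (mem_baseSet_trivializationAt ℂ L (τ q)))
  have hστ : ContMDiffAt J J ∞ (fun q' => σ (τ q')) q := hσ.contMDiffAt.comp q hτ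
  have h1 : ContMDiffAt J 𝓘(ℝ, ℂ) ∞ (fun q' : CircleBundle L => (e q'.1).2) q :=
    (contMDiffAt_totalSpace.1 hL₁.contMDiff.contMDiffAt).2
  have h2 : ContMDiffAt J 𝓘(ℝ, ℂ) ∞ (fun q' : CircleBundle L => (e (σ (τ q')).1).2) q := by
    have := (contMDiffAt_totalSpace.1 (hL₁.contMDiff.contMDiffAt.comp q hστ)).2
    simp only [Function.comp_apply, hσ.apply_self] at this
    exact this
  have hfib : ∀ q' : CircleBundle L, τ q' ∈ U → τ q' ∈ e.baseSet →
      (e (σ (τ q')).1).2 ≠ 0 ∧ (⟨τ q', c q' • s (τ q')⟩ : TotalSpace ℂ L) = q'.1 := by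
    intro q' hU he
    let ψ := e.continuousLinearEquivAt ℂ (τ q') he
    have hψ : ∀ v : L (τ q'), (e ⟨τ q', v⟩).2 = ψ v := fun v => by
      have h := congrArg Prod.snd (e.apply_eq_prod_continuousLinearEquivAt ℂ (τ q') he v)
      exact h
    have hs : s (τ q') ≠ 0 := fun h => by simpa [h] using hσ.norm_eq_one hU
    have hne : ψ (s (τ q')) ≠ 0 := fun h => hs (ψ.map_eq_zero_iff.1 h)
    have e1 : (e (σ (τ q')).1).2 = ψ (s (τ q')) := by rw [hσ.val _ hU, hψ]
    refine ⟨e1 ▸ hne, ?_⟩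
    have e2 : c q' • s (τ q') = q'.1.2 := by
      apply ψ.injective
      rw [map_smul, smul_eq_mul]
      simp only [c, e1]
      rw [div_mul_cancel₀ _ hne]
      exact hψ q'.1.2
    rw [e2]
    rfl
  have hq := hfib q hσ.mem (mem_baseSet_trivializationAt ℂ L (τ q))
  have hcq : c q = 1 := by
    simp only [c, hσ.apply_self]
    exact div_self (by simpa only [hσ.apply_self] using hq.1)
  have hc : ContMDiffAt J 𝓘(ℝ, ℂ) ∞ c q := by
    have hdiv : ContDiffAt ℝ ∞ (fun p : ℂ × ℂ => p.1 / p.2) ((e q.1).2, (e (σ (τ q)).1).2) :=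
      (contDiffAt_fst.div (𝕜 := ℂ) contDiffAt_snd hq.1).restrict_scalars ℝ
    exact hdiv.contMDiffAt.comp q (h1.prodMk_space h2)
  have hlog : ContDiffAt ℝ ∞ (fun z : ℂ => (Complex.log z).im) (c q) := by
    rw [hcq]
    exact Complex.imCLM.contDiff.contDiffAt.comp _
      ((Complex.contDiffAt_log (n := ∞) (by simp)).restrict_scalars ℝ)
  refine ⟨fun q' => (Complex.log (c q')).im, hlog.contMDiffAt.comp q hc, by simp [hcq], ?_⟩
  filter_upwards [hσ.eventually_mem hL₁, hmem] with q' hU he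
  have h := (hfib q' hU he).2
  have hn : ‖c q'‖ = 1 := by
    have h3 : ‖c q' • s (τ q')‖ = 1 := by
      have h4 := q'.2
      rw [← h] at h4
      exact h4
    rwa [norm_smul, hσ.norm_eq_one hU, mul_one] at h3
  have hexp : (Circle.exp (Complex.log (c q')).im : ℂ) = c q' := by
    have := congrArg (fun z : Circle => (z : ℂ)) (Circle.exp_arg ⟨c q', mem_sphere_zero_iff_norm.2 hn⟩)
    rw [Complex.log_im]
    exact this
  refine Subtype.ext ?_
  rw [smul_val, hexp, hσ.val _ hU]
  exact h

end IsLocalSection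

end CircleBundle

end CircleBundleGeometry

section CircleBundleTangent

variable {E : Type*} [NormedAddCommGroup E] [NormedSpace ℝ E]
  {H : Type*} [TopologicalSpace H] {I : ModelWithCorners ℝ E H}
  {X : Type*} [TopologicalSpace X] [ChartedSpace H X] [IsManifold I ∞ X]
  {L : X → Type*} [TopologicalSpace (TotalSpace ℂ L)]
  [∀ x, NormedAddCommGroup (L x)] [∀ x, InnerProductSpace ℂ (L x)]
  [FiberBundle ℂ L] [VectorBundle ℝ ℂ L] [VectorBundle ℂ ℂ L] [ContMDiffVectorBundle ∞ ℂ L I]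
  {E₁ : Type*} [NormedAddCommGroup E₁] [NormedSpace ℝ E₁]
  {H₁ : Type*} [TopologicalSpace H₁] {J : ModelWithCorners ℝ E₁ H₁}
  [ChartedSpace H₁ (CircleBundle L)] [IsManifold J ∞ (CircleBundle L)]

namespace CircleBundle

variable (J) in
/-- The generator `∂/∂θ` of the action of `U(1)` on the circle bundle. -/
noncomputable def angular (q : CircleBundle L) : TangentSpace J q :=
  (mfderiv 𝓘(ℝ, ℝ) J (fun t : ℝ => Circle.exp t • q) 0 (1 : ℝ) : E₁)

theorem mdifferentiableAt_exp_smul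
    (hL₁ : Manifold.IsSmoothEmbedding J (I.prod 𝓘(ℝ, ℂ)) ∞
      (Subtype.val : CircleBundle L → TotalSpace ℂ L)) (q : CircleBundle L) (t : ℝ) :
    MDifferentiableAt 𝓘(ℝ, ℝ) J (fun t : ℝ => Circle.exp t • q) t :=
  (contMDiffAt_exp_smul hL₁ contMDiffAt_id contMDiffAt_const).mdifferentiableAt (by simp)

theorem mdifferentiableAt_τ
    (hL₁ : Manifold.IsSmoothEmbedding J (I.prod 𝓘(ℝ, ℂ)) ∞
      (Subtype.val : CircleBundle L → TotalSpace ℂ L)) (q : CircleBundle L) :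
    MDifferentiableAt J I (τ : CircleBundle L → X) q :=
  (contMDiff_τ hL₁).mdifferentiableAt (by simp)

theorem mfderiv_τ_angular
    (hL₁ : Manifold.IsSmoothEmbedding J (I.prod 𝓘(ℝ, ℂ)) ∞
      (Subtype.val : CircleBundle L → TotalSpace ℂ L)) (q : CircleBundle L) :
    mfderiv J I (τ : CircleBundle L → X) q (angular J q) = 0 := by
  have h := mfderiv_comp_apply_of_eq (I'' := I) (0 : ℝ) (mdifferentiableAt_τ hL₁ q)
    (mdifferentiableAt_exp_smul hL₁ q 0) (exp_zero_smul q) (1 : ℝ)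
  refine h.symm.trans ?_
  have e : (τ : CircleBundle L → X) ∘ (fun t : ℝ => Circle.exp t • q) = fun _ => τ q := rfl
  rw [e, mfderiv_const]
  rfl

theorem mfderiv_angular {F : Type*} [NormedAddCommGroup F] [NormedSpace ℝ F]
    (hL₁ : Manifold.IsSmoothEmbedding J (I.prod 𝓘(ℝ, ℂ)) ∞
      (Subtype.val : CircleBundle L → TotalSpace ℂ L)) {q : CircleBundle L}
    {f : CircleBundle L → F} (hf : MDifferentiableAt J 𝓘(ℝ, F) f q) {f' : F}
    (h : HasDerivAt (fun t : ℝ => f (Circle.exp t • q)) f' 0) :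
    mvfderiv J f q (angular J q) = f' := by
  have h1 := mfderiv_comp_apply_of_eq (0 : ℝ) hf
    (mdifferentiableAt_exp_smul hL₁ q 0) (exp_zero_smul q) (1 : ℝ)
  rw [mfderiv_eq_fderiv] at h1
  refine h1.symm.trans ?_
  have h2 := h.hasFDerivAt.fderiv
  refine (congrArg (fun A : ℝ →L[ℝ] F => A 1) h2).trans ?_
  simp

theorem connectionForm_angular {nabla : CovariantDerivative I ℂ L}
    {α : DiffForm J (CircleBundle L) 1} (hα : IsConnectionForm nabla α) (q : CircleBundle L) :
    α q ![angular J q] = 1 / (2 * Real.pi) :=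
  (DiffForm.apply_congr α (exp_zero_smul q).symm _).trans (hα.fiber q 0)

namespace IsLocalSection

variable {q : CircleBundle L} {U : Set X} {s : Π x, L x} {σ : X → CircleBundle L}

theorem mfderiv_τ_mfderiv (hσ : IsLocalSection J I q U s σ)
    (hL₁ : Manifold.IsSmoothEmbedding J (I.prod 𝓘(ℝ, ℂ)) ∞
      (Subtype.val : CircleBundle L → TotalSpace ℂ L)) (v : TangentSpace I (τ q)) :
    mfderiv J I (τ : CircleBundle L → X) q (mfderiv I J σ (τ q) v : E₁) = v := by
  have h := mfderiv_comp_apply_of_eq (I'' := I) (τ q) (mdifferentiableAt_τ hL₁ q)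
    (hσ.contMDiffAt.mdifferentiableAt (by simp)) hσ.apply_self v
  refine h.symm.trans ?_
  have e : (τ : CircleBundle L → X) ∘ σ =ᶠ[𝓝 (τ q)] id := by
    filter_upwards [hσ.isOpen.mem_nhds hσ.mem] with x hx using hσ.τ_apply hx
  rw [e.mfderiv_eq, mfderiv_id]
  rfl

/-- Vertical vectors are multiples of `∂/∂θ`. -/
theorem exists_smul_angular (hσ : IsLocalSection J I q U s σ)
    (hL₁ : Manifold.IsSmoothEmbedding J (I.prod 𝓘(ℝ, ℂ)) ∞
      (Subtype.val : CircleBundle L → TotalSpace ℂ L)) {w : TangentSpace J q}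
    (hw : mfderiv J I (τ : CircleBundle L → X) q w = 0) : ∃ c : ℝ, w = c • angular J q := by
  obtain ⟨θ, hθ, hθq, hev⟩ := hσ.exists_angle hL₁
  have hθd : MDifferentiableAt J 𝓘(ℝ, ℝ) θ q := hθ.mdifferentiableAt (by simp)
  let G : X × ℝ → CircleBundle L := fun p => Circle.exp p.2 • σ p.1
  let T : CircleBundle L → X × ℝ := fun q' => (τ q', θ q')
  have hTq : T q = (τ q, 0) := by simp only [T, hθq]
  have hG : MDifferentiableAt (I.prod 𝓘(ℝ, ℝ)) J G (τ q, 0) :=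
    (contMDiffAt_exp_smul hL₁ contMDiffAt_snd
      (hσ.contMDiffAt.comp (τ q, (0 : ℝ)) contMDiffAt_fst)).mdifferentiableAt (by simp)
  have hT : HasMFDerivAt J (I.prod 𝓘(ℝ, ℝ)) T q
      ((mfderiv J I (τ : CircleBundle L → X) q).prod (mfderiv J 𝓘(ℝ, ℝ) θ q)) :=
    (mdifferentiableAt_τ hL₁ q).hasMFDerivAt.prodMk hθd.hasMFDerivAt
  have hGT : G ∘ T =ᶠ[𝓝 q] id := hev
  have h1 := mfderiv_comp_apply_of_eq q hG hT.mdifferentiableAt hTq w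
  rw [hGT.mfderiv_eq, mfderiv_id, hT.mfderiv] at h1
  have hι : HasMFDerivAt 𝓘(ℝ, ℝ) (I.prod 𝓘(ℝ, ℝ)) (fun t : ℝ => (τ q, t)) 0
      ((0 : ℝ →L[ℝ] E).prod (ContinuousLinearMap.id ℝ ℝ)) :=
    (hasMFDerivAt_const (τ q) (0 : ℝ)).prodMk (hasMFDerivAt_id (0 : ℝ))
  have hcomp : G ∘ (fun t : ℝ => (τ q, t)) = fun t : ℝ => Circle.exp t • q := by
    funext t
    simp only [G, Function.comp_apply, hσ.apply_self]
  refine ⟨(mfderiv J 𝓘(ℝ, ℝ) θ q w : ℝ), ?_⟩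
  set c : ℝ := (mfderiv J 𝓘(ℝ, ℝ) θ q w : ℝ) with hc
  have h2 := mfderiv_comp_apply (0 : ℝ) hG hι.mdifferentiableAt c
  rw [hcomp, hι.mfderiv] at h2
  have h3 : (mfderiv 𝓘(ℝ, ℝ) J (fun t : ℝ => Circle.exp t • q) 0 c : E₁) = c • angular J q := by
    have h4 : ∀ D : ℝ →L[ℝ] E₁, D c = c • D 1 := fun D => by
      rw [← D.map_smul, smul_eq_mul, mul_one]
    exact h4 (mfderiv 𝓘(ℝ, ℝ) J (fun t : ℝ => Circle.exp t • q) 0)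
  rw [← h3]
  refine Eq.trans ?_ h2.symm
  refine Eq.trans h1 ?_
  have e : ((mfderiv J I (τ : CircleBundle L → X) q w : E), c) = ((0 : E), c) := by
    rw [hw]; rfl
  exact congrArg (mfderiv (I.prod 𝓘(ℝ, ℝ)) J G (τ q, 0) : E × ℝ →L[ℝ] E₁) e

end IsLocalSection

end CircleBundle

end CircleBundleTangent

namespace Complexify

variable {V : Type*} [AddCommGroup V] [Module ℝ V] [TopologicalSpace V]

theorem apply_add (α : V [⋀^Fin 1]→L[ℝ] ℝ) (u v : V) : α ![u + v] = α ![u] + α ![v] :=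
  α.toAlternatingMap.map_vecCons_add ![] u v

theorem apply_smul (α : V [⋀^Fin 1]→L[ℝ] ℝ) (c : ℝ) (v : V) : α ![c • v] = c * α ![v] :=
  α.toAlternatingMap.map_vecCons_smul ![] c v

end Complexify

section CircleBundleFields

variable {E : Type*} [NormedAddCommGroup E] [NormedSpace ℝ E]
  {H : Type*} [TopologicalSpace H] {I : ModelWithCorners ℝ E H}
  {X : Type*} [TopologicalSpace X] [ChartedSpace H X] [IsManifold I ∞ X]
  {L : X → Type*} [TopologicalSpace (TotalSpace ℂ L)]
  [∀ x, NormedAddCommGroup (L x)] [∀ x, InnerProductSpace ℂ (L x)]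
  [FiberBundle ℂ L] [VectorBundle ℝ ℂ L] [VectorBundle ℂ ℂ L] [ContMDiffVectorBundle ∞ ℂ L I]
  {E₁ : Type*} [NormedAddCommGroup E₁] [NormedSpace ℝ E₁]
  {H₁ : Type*} [TopologicalSpace H₁] {J : ModelWithCorners ℝ E₁ H₁}
  [ChartedSpace H₁ (CircleBundle L)] [IsManifold J ∞ (CircleBundle L)]
  {nabla : CovariantDerivative I ℂ L} {α : DiffForm J (CircleBundle L) 1}

open CircleBundle

/-- The Leibniz rule for complex functions. -/
theorem IsHermitianConnection.leibniz (hnabla : IsHermitianConnection nabla) {f : X → ℂ}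
    {s : Π x, L x} {x : X} (hf : ContMDiffAt I 𝓘(ℝ, ℂ) ∞ f x)
    (hs : ContMDiffAt I (I.prod 𝓘(ℝ, ℂ)) ∞ (fun x => TotalSpace.mk' ℂ x (s x)) x)
    (v : TangentSpace I x) :
    nabla (fun y => f y • s y) x v = f x • nabla s x v + mvfderiv I f x v • s x := by
  have hre : ContMDiffAt I 𝓘(ℝ, ℝ) ∞ (fun x => (f x).re) x :=
    (Complex.reCLM.contDiff (n := ∞)).contMDiff.contMDiffAt.comp x hf
  have him : ContMDiffAt I 𝓘(ℝ, ℝ) ∞ (fun x => (f x).im) x :=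
    (Complex.imCLM.contDiff (n := ∞)).contMDiff.contMDiffAt.comp x hf
  have hsd := hs.mdifferentiableAt (by simp : (∞ : WithTop ℕ∞) ≠ 0)
  have hsm : ∀ {a : X → ℝ}, ContMDiffAt I 𝓘(ℝ, ℝ) ∞ a x →
      ContMDiffAt I (I.prod 𝓘(ℝ, ℂ)) ∞ (fun x => TotalSpace.mk' ℂ x ((a • s) x)) x := fun ha =>
    LineBundle.contMDiffAt_smul
      ((Complex.ofRealCLM.contDiff (n := ∞)).contMDiff.contMDiffAt.comp x ha) hs
  have hsI : MDifferentiableAt I (I.prod 𝓘(ℝ, ℂ))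
      (fun y => TotalSpace.mk' ℂ y (Complex.I • ((fun x => (f x).im) • s) y)) x :=
    (LineBundle.contMDiffAt_smul (c := fun _ => Complex.I) contMDiffAt_const
      (hsm him)).mdifferentiableAt (by simp)
  have e : (fun y => f y • s y) = ((fun x => (f x).re) • s)
      + fun y => Complex.I • ((fun x => (f x).im) • s) y := by
    funext y
    change f y • s y = ((f y).re : ℂ) • s y + Complex.I • ((f y).im : ℂ) • s y
    rw [smul_smul, ← add_smul, mul_comm Complex.I, Complex.re_add_im]
  have hd : ∀ {a : X → ℝ}, ContMDiffAt I 𝓘(ℝ, ℝ) ∞ a x → nabla (a • s) x v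
      = (a x : ℂ) • nabla s x v + ((mvfderiv I a x v : ℝ) : ℂ) • s x := fun ha => by
    rw [nabla.isCovariantDerivativeOnUniv.leibniz hsd (ha.mdifferentiableAt (by simp))]
    rfl
  have hdre : mvfderiv I (fun x => (f x).re) x v = (mvfderiv I f x v).re :=
    mfderiv_comp_apply x (Complex.reCLM.differentiableAt.mdifferentiableAt)
      (hf.mdifferentiableAt (by simp)) v |>.trans (by
        rw [mfderiv_eq_fderiv, Complex.reCLM.fderiv]; rfl)
  have hdim : mvfderiv I (fun x => (f x).im) x v = (mvfderiv I f x v).im :=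
    mfderiv_comp_apply x (Complex.imCLM.differentiableAt.mdifferentiableAt)
      (hf.mdifferentiableAt (by simp)) v |>.trans (by
        rw [mfderiv_eq_fderiv, Complex.imCLM.fderiv]; rfl)
  rw [e, nabla.isCovariantDerivativeOnUniv.add ((hsm hre).mdifferentiableAt (by simp)) hsI]
  change nabla _ x v + nabla _ x v = _
  rw [hnabla.smul Complex.I _ x v ((hsm him).mdifferentiableAt (by simp)), hd hre, hd him,
    hdre, hdim]
  have e1 := Complex.re_add_im (f x)
  have e2 := Complex.re_add_im (mvfderiv I f x v)
  conv_rhs => rw [← e1, ← e2]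
  module

theorem tildeSection_exp_smul (s : Π x, L x) (q : CircleBundle L) (t : ℝ) :
    tildeSection s (Circle.exp t • q) = Complex.exp (-(t * Complex.I)) * tildeSection s q := by
  change inner ℂ ((Circle.exp t : ℂ) • q.1.2) (s q.1.1) = _
  rw [inner_smul_left, Circle.coe_exp, ← Complex.exp_conj]
  simp [tildeSection]

theorem contMDiff_tildeSection (hL : IsSmoothHermitian I L)
    (hL₁ : Manifold.IsSmoothEmbedding J (I.prod 𝓘(ℝ, ℂ)) ∞
      (Subtype.val : CircleBundle L → TotalSpace ℂ L)) {t : Π x, L x}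
    (ht : IsSmoothSectionOn I t Set.univ) : IsSmoothFun J (tildeSection t) := by
  intro q
  obtain ⟨U, s, σ, hσ⟩ := exists_isLocalSection hL hL₁ q
  obtain ⟨θ, hθ, hθq, hev⟩ := hσ.exists_angle hL₁
  have h1 : ContMDiffAt I 𝓘(ℝ, ℂ) ∞ (fun x => inner ℂ (s x) (t x)) (τ q) :=
    (hL U s t hσ.isOpen hσ.smooth_section (ht.mono (subset_univ U))).contMDiffAt
      (hσ.isOpen.mem_nhds hσ.mem)
  have h2 : ContMDiffAt J 𝓘(ℝ, ℂ) ∞ (fun q' => inner ℂ (s (τ q')) (t (τ q'))) q :=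
    h1.comp q (contMDiff_τ hL₁).contMDiffAt
  have hexp : ContDiff ℝ ∞ fun a : ℝ => Complex.exp (-(a * Complex.I)) :=
    (Complex.ofRealCLM.contDiff.mul contDiff_const).neg.cexp
  have h3 := (contDiff_mul (𝕜 := ℝ) (𝔸 := ℂ) (n := ∞)).contMDiff.contMDiffAt.comp q
    ((hexp.contMDiff.contMDiffAt.comp q hθ).prodMk_space h2)
  refine h3.congr_of_eventuallyEq ?_
  filter_upwards [hev, hσ.eventually_mem hL₁] with q' hq' hU
  conv_lhs => rw [← hq']
  rw [tildeSection_exp_smul, hσ.tildeSection_apply hU]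
  rfl

theorem mvfderiv_tildeSection_angular (hL : IsSmoothHermitian I L)
    (hL₁ : Manifold.IsSmoothEmbedding J (I.prod 𝓘(ℝ, ℂ)) ∞
      (Subtype.val : CircleBundle L → TotalSpace ℂ L)) {t : Π x, L x}
    (ht : IsSmoothSectionOn I t Set.univ) (q : CircleBundle L) :
    mvfderiv J (tildeSection t) q (angular J q) = -Complex.I * tildeSection t q := by
  refine mfderiv_angular hL₁ ((contMDiff_tildeSection hL hL₁ ht).mdifferentiableAt q) ?_
  simp only [tildeSection_exp_smul]
  have h1 : HasDerivAt (fun a : ℝ => -((a : ℂ) * Complex.I)) (-Complex.I) 0 := by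
    simpa using ((Complex.ofRealCLM.hasDerivAt (x := 0)).mul_const Complex.I).fun_neg
  have h2 := (h1.cexp).mul_const (tildeSection t q)
  simpa using h2

/-- The derivative of `s̃` in terms of the covariant derivative of `s`. -/
theorem mvfderiv_tildeSection_smul (hL : IsSmoothHermitian I L)
    (hnabla : IsHermitianConnection nabla)
    (hL₁ : Manifold.IsSmoothEmbedding J (I.prod 𝓘(ℝ, ℂ)) ∞
      (Subtype.val : CircleBundle L → TotalSpace ℂ L))
    (hα : IsConnectionForm nabla α) {t : Π x, L x}
    (ht : IsSmoothSectionOn I t Set.univ) (q : CircleBundle L) (w : TangentSpace J q) :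
    mvfderiv J (tildeSection t) q w • (q.1.2 : L (τ q))
      = nabla t (τ q) (mfderiv J I (τ : CircleBundle L → X) q w)
        - (2 * Real.pi * Complex.I * (α q ![w] : ℝ) : ℂ) • t (τ q) := by
  obtain ⟨U, s, σ, hσ⟩ := exists_isLocalSection hL hL₁ q
  set v := mfderiv J I (τ : CircleBundle L → X) q w with hv
  let w₀ : TangentSpace J q := (mfderiv I J σ (τ q) v : E₁)
  have hker : mfderiv J I (τ : CircleBundle L → X) q (w - w₀) = 0 := by
    rw [map_sub, sub_eq_zero]
    exact (hσ.mfderiv_τ_mfderiv hL₁ v).symm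
  obtain ⟨c, hc⟩ := hσ.exists_smul_angular hL₁ hker
  have hw : w = w₀ + c • angular J q := by rw [← hc]; abel
  have hUn : U ∈ 𝓝 (τ q) := hσ.isOpen.mem_nhds hσ.mem
  have hsq : s (τ q) = (q.1.2 : L (τ q)) := by
    have h1 := hσ.val _ hσ.mem
    rw [hσ.apply_self] at h1
    exact (eq_of_heq (TotalSpace.mk.inj (h1 : (⟨τ q, q.1.2⟩ : TotalSpace ℂ L) = _)).2).symm
  let f : X → ℂ := fun x => inner ℂ (s x) (t x)
  have hf : ContMDiffAt I 𝓘(ℝ, ℂ) ∞ f (τ q) :=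
    (hL U s t hσ.isOpen hσ.smooth_section (ht.mono (subset_univ U))).contMDiffAt hUn
  have hs := hσ.smooth_section.contMDiffAt hUn
  have htf : ∀ x ∈ U, t x = f x • s x := fun x hx =>
    (LineBundle.inner_smul_self (hσ.norm_eq_one hx) (t x)).symm
  have hfq : f (τ q) = tildeSection t q := by simp only [f, hsq]; rfl
  have htilde := (contMDiff_tildeSection (J := J) hL hL₁ ht).mdifferentiableAt q
  have hn : nabla t (τ q) v = f (τ q) • nabla s (τ q) v + mvfderiv I f (τ q) v • s (τ q) := by
    rw [← hnabla.leibniz hf hs v]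
    have := nabla.isCovariantDerivativeOnUniv.congr_of_eventuallyEq
      ((ht.contMDiffAt univ_mem).mdifferentiableAt (by simp))
      ((LineBundle.contMDiffAt_smul hf hs).mdifferentiableAt (by simp)) univ_mem
      (σ := t) (σ' := fun y => f y • s y) (x := τ q) (by filter_upwards [hUn] using htf)
    rw [this]
  have hns : nabla s (τ q) v
      = (2 * Real.pi * Complex.I * (α q ![w₀] : ℝ) : ℂ) • s (τ q) := by
    rw [hα.covariantDerivative U s σ hσ.isOpen hσ.smooth hσ.val _ hσ.mem v]
    have h1 : α (σ (τ q)) ![mfderiv I J σ (τ q) v] = α q ![w₀] :=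
      DiffForm.apply_congr α hσ.apply_self _
    rw [h1]
  have hd : mvfderiv J (tildeSection t) q w₀ = mvfderiv I f (τ q) v := by
    have h1 := mfderiv_comp_apply_of_eq (τ q) htilde
      (hσ.contMDiffAt.mdifferentiableAt (by simp)) hσ.apply_self v
    have h2 : tildeSection t ∘ σ =ᶠ[𝓝 (τ q)] f := by
      filter_upwards [hUn] with x hx using hσ.tildeSection_apply hx t
    rw [h2.mfderiv_eq] at h1
    exact h1.symm
  have h2π : (2 * Real.pi * (1 / (2 * Real.pi)) : ℂ) = 1 := by
    have := Real.pi_ne_zero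
    have : (Real.pi : ℂ) ≠ 0 := by exact_mod_cast this
    field_simp
  rw [hw, map_add, map_smul, hd, mvfderiv_tildeSection_angular hL hL₁ ht, hn, hns,
    htf _ hσ.mem, apply_add, apply_smul, connectionForm_angular hα, ← hfq, ← hsq]
  rw [smul_smul, smul_smul, ← add_smul, ← sub_smul]
  congr 1
  push_cast
  rw [Complex.real_smul]
  linear_combination (Complex.I * c * f (τ q)) * h2π

end CircleBundleFields

/-! ### The symplectic form `d(r α)` -/

section PosReals

theorem extChartAt_posReals_apply (r r' : PosReals) : extChartAt 𝓘(ℝ, ℝ) r r' = (r' : ℝ) := by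
  simp [extChartAt, TopologicalSpace.Opens.chartAt_eq, chartAt_self_eq]

theorem extChartAt_posReals_symm {r : PosReals} {t : ℝ}
    (ht : t ∈ (extChartAt 𝓘(ℝ, ℝ) r).target) :
    (((extChartAt 𝓘(ℝ, ℝ) r).symm t : PosReals) : ℝ) = t := by
  rw [← extChartAt_posReals_apply r, (extChartAt 𝓘(ℝ, ℝ) r).right_inv ht]

theorem contMDiff_posReals_val :
    ContMDiff 𝓘(ℝ, ℝ) 𝓘(ℝ, ℝ) ∞ (Subtype.val : PosReals → ℝ) :=
  contMDiff_subtype_val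

theorem mvfderiv_posReals_val (r : PosReals) (t : TangentSpace 𝓘(ℝ, ℝ) r) :
    mvfderiv 𝓘(ℝ, ℝ) (Subtype.val : PosReals → ℝ) r t = (t : ℝ) := by
  have h : (Subtype.val : PosReals → ℝ) = extChartAt 𝓘(ℝ, ℝ) r :=
    funext fun r' => (extChartAt_posReals_apply r r').symm
  have h2 := DiffForm.mfderiv_extChartAt_self' (I := 𝓘(ℝ, ℝ)) r
  rw [← h] at h2
  exact congrArg (fun A : ℝ →L[ℝ] ℝ => A t) h2

end PosReals

section Flat

variable {F : Type*} [NormedAddCommGroup F] [NormedSpace ℝ F]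

theorem extDeriv_one_apply {A : F → F [⋀^Fin 1]→L[ℝ] ℝ} {y : F} (hA : DifferentiableAt ℝ A y)
    (u v : F) :
    extDeriv A y ![u, v]
      = fderiv ℝ (fun z => A z ![v]) y u - fderiv ℝ (fun z => A z ![u]) y v := by
  rw [extDeriv_apply hA]
  refine (Fin.sum_univ_two _).trans ?_
  have h0 : (0 : Fin 2).removeNth ![u, v] = ![v] := by
    ext i; fin_cases i; rfl
  have h1 : (1 : Fin 2).removeNth ![u, v] = ![u] := by
    ext i; fin_cases i; rfl
  rw [h0, h1]
  simp [sub_eq_add_neg]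

theorem comp_fst_apply (B : F [⋀^Fin 1]→L[ℝ] ℝ) (w : F × ℝ) :
    B.compContinuousLinearMap (ContinuousLinearMap.fst ℝ F ℝ) ![w] = B ![w.1] := by
  refine congrArg B ?_
  ext i; fin_cases i; rfl

theorem contDiffOn_smul_comp_fst {A : F → F [⋀^Fin 1]→L[ℝ] ℝ} {s : Set F} {t : Set ℝ}
    (hA : ContDiffOn ℝ ∞ A s) :
    ContDiffOn ℝ ∞ (fun z : F × ℝ =>
      z.2 • (A z.1).compContinuousLinearMap (ContinuousLinearMap.fst ℝ F ℝ)) (s ×ˢ t) := by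
  have h := (ContinuousAlternatingMap.compContinuousLinearMapCLM (ContinuousLinearMap.fst ℝ F ℝ) :
    (F [⋀^Fin 1]→L[ℝ] ℝ) →L[ℝ] (F × ℝ) [⋀^Fin 1]→L[ℝ] ℝ).contDiff (n := ∞)
  exact contDiffOn_snd.smul
    (h.comp_contDiffOn (hA.comp contDiffOn_fst fun z hz => hz.1))

theorem extDeriv_smul_comp_fst {A : F → F [⋀^Fin 1]→L[ℝ] ℝ} {y : F × ℝ}
    (hA : ContDiffAt ℝ ∞ A y.1) (u v : F × ℝ) :
    extDeriv (fun z : F × ℝ =>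
      z.2 • (A z.1).compContinuousLinearMap (ContinuousLinearMap.fst ℝ F ℝ)) y ![u, v]
      = u.2 * A y.1 ![v.1] - v.2 * A y.1 ![u.1] + y.2 * extDeriv A y.1 ![u.1, v.1] := by
  have hAd := hA.differentiableAt (by simp : (∞ : WithTop ℕ∞) ≠ 0)
  have h := (ContinuousAlternatingMap.compContinuousLinearMapCLM (ContinuousLinearMap.fst ℝ F ℝ) :
    (F [⋀^Fin 1]→L[ℝ] ℝ) →L[ℝ] (F × ℝ) [⋀^Fin 1]→L[ℝ] ℝ).differentiableAt (x := A y.1)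
  have hB : DifferentiableAt ℝ (fun z : F × ℝ =>
      z.2 • (A z.1).compContinuousLinearMap (ContinuousLinearMap.fst ℝ F ℝ)) y :=
    differentiableAt_snd.smul (h.comp y (hAd.comp y differentiableAt_fst))
  have hw : ∀ w a : F × ℝ, fderiv ℝ (fun z : F × ℝ =>
      (z.2 • (A z.1).compContinuousLinearMap (ContinuousLinearMap.fst ℝ F ℝ)) ![w]) y a
      = a.2 * A y.1 ![w.1] + y.2 * fderiv ℝ (fun z => A z ![w.1]) y.1 a.1 := by
    intro w a
    have e : (fun z : F × ℝ =>
        (z.2 • (A z.1).compContinuousLinearMap (ContinuousLinearMap.fst ℝ F ℝ)) ![w])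
        = fun z : F × ℝ => z.2 * A z.1 ![w.1] := by
      funext z
      rw [← comp_fst_apply]
      rfl
    have hAw : DifferentiableAt ℝ (fun z => A z ![w.1]) y.1 :=
      hAd.continuousAlternatingMap_apply_const _
    have h1 : HasFDerivAt (fun z : F × ℝ => A z.1 ![w.1])
        ((fderiv ℝ (fun z => A z ![w.1]) y.1).comp (ContinuousLinearMap.fst ℝ F ℝ)) y :=
      hAw.hasFDerivAt.comp y hasFDerivAt_fst
    have h2 : fderiv ℝ (fun z : F × ℝ => z.2 * A z.1 ![w.1]) y = _ :=
      (hasFDerivAt_snd.mul h1).fderiv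
    rw [e, h2]
    simp
    ring
  rw [extDeriv_one_apply hB, extDeriv_one_apply hAd, hw, hw]
  ring

end Flat

section InducedForm

variable {X : Type*} [TopologicalSpace X]
  {L : X → Type*} [TopologicalSpace (TotalSpace ℂ L)] [∀ x, NormedAddCommGroup (L x)]
  {E₁ : Type*} [NormedAddCommGroup E₁] [NormedSpace ℝ E₁]
  {H₁ : Type*} [TopologicalSpace H₁] {J : ModelWithCorners ℝ E₁ H₁} [J.Boundaryless]
  [ChartedSpace H₁ (CircleBundle L)] [IsManifold J ∞ (CircleBundle L)]
  {α : DiffForm J (CircleBundle L) 1}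

theorem rAlpha_inChart (p : InducedSpace L) {z : E₁ × ℝ}
    (hz : z ∈ (extChartAt (J.prod 𝓘(ℝ, ℝ)) p).target) :
    (rAlpha α).inChart p z = z.2 • (α.inChart p.1 z.1).compContinuousLinearMap
      (ContinuousLinearMap.fst ℝ E₁ ℝ) := by
  have hz' := hz
  rw [extChartAt_prod, PartialEquiv.prod_target] at hz'
  have e1 : (((extChartAt (J.prod 𝓘(ℝ, ℝ)) p).symm z).2 : ℝ) = z.2 := by
    rw [extChartAt_prod]
    exact extChartAt_posReals_symm hz'.2
  have e2 : (Prod.fst : InducedSpace L → CircleBundle L) ∘ (extChartAt (J.prod 𝓘(ℝ, ℝ)) p).symm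
      = (extChartAt J p.1).symm ∘ (Prod.fst : E₁ × ℝ → E₁) := by
    funext z
    rw [extChartAt_prod]
    rfl
  have h1 := DiffForm.pullback_comp (I := J) (I' := J.prod 𝓘(ℝ, ℝ)) (I'' := 𝓘(ℝ, E₁ × ℝ)) α
    (f := (Prod.fst : InducedSpace L → CircleBundle L))
    (g := (extChartAt (J.prod 𝓘(ℝ, ℝ)) p).symm) (x := z) mdifferentiableAt_fst
    (DiffForm.mdifferentiableAt_extChartAt_symm hz)
  have h2 := DiffForm.pullback_comp (I := J) (I' := 𝓘(ℝ, E₁)) (I'' := 𝓘(ℝ, E₁ × ℝ)) α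
    (f := (extChartAt J p.1).symm) (g := (Prod.fst : E₁ × ℝ → E₁)) (x := z)
    (DiffForm.mdifferentiableAt_extChartAt_symm hz'.1)
    differentiableAt_fst.mdifferentiableAt
  have h3 : DiffForm.pullback (I' := 𝓘(ℝ, E₁ × ℝ)) (Prod.fst : E₁ × ℝ → E₁)
      (DiffForm.pullback (I' := 𝓘(ℝ, E₁)) (extChartAt J p.1).symm α) z
      = (α.inChart p.1 z.1).compContinuousLinearMap (ContinuousLinearMap.fst ℝ E₁ ℝ) := by
    unfold DiffForm.pullback
    rw [mfderiv_eq_fderiv, fderiv_fst]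
    rfl
  rw [← h3, ← h2, ← e2, h1, ← e1]
  rfl

theorem isSmooth_rAlpha (hα : α.IsSmooth) : (rAlpha α).IsSmooth := by
  intro p
  have h := contDiffOn_smul_comp_fst (t := (extChartAt 𝓘(ℝ, ℝ) p.2).target) (hα p.1)
  have e : (extChartAt (J.prod 𝓘(ℝ, ℝ)) p).target
      = (extChartAt J p.1).target ×ˢ (extChartAt 𝓘(ℝ, ℝ) p.2).target := by
    rw [extChartAt_prod, PartialEquiv.prod_target]
  rw [← e] at h
  exact h.congr fun z hz => rAlpha_inChart p hz

theorem inducedForm_apply (hα : α.IsSmooth) (p : InducedSpace L) (u v : E₁ × ℝ) :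
    (inducedForm α p : (E₁ × ℝ) [⋀^Fin 2]→L[ℝ] ℝ) ![u, v]
      = u.2 * (α p.1 : E₁ [⋀^Fin 1]→L[ℝ] ℝ) ![v.1] - v.2 * (α p.1 : E₁ [⋀^Fin 1]→L[ℝ] ℝ) ![u.1]
        + (p.2 : ℝ) * (α.d p.1 : E₁ [⋀^Fin 2]→L[ℝ] ℝ) ![u.1, v.1] := by
  have hev : (rAlpha α).inChart p =ᶠ[𝓝 (extChartAt (J.prod 𝓘(ℝ, ℝ)) p p)] fun z =>
      z.2 • (α.inChart p.1 z.1).compContinuousLinearMap (ContinuousLinearMap.fst ℝ E₁ ℝ) := by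
    filter_upwards [extChartAt_target_mem_nhds (I := J.prod 𝓘(ℝ, ℝ)) p] with z hz
      using rAlpha_inChart p hz
  have e : extChartAt (J.prod 𝓘(ℝ, ℝ)) p p = (extChartAt J p.1 p.1, (p.2 : ℝ)) := by
    rw [extChartAt_prod]
    exact Prod.ext rfl (extChartAt_posReals_apply p.2 p.2)
  have h1 : inducedForm α p = extDeriv ((rAlpha α).inChart p)
      (extChartAt (J.prod 𝓘(ℝ, ℝ)) p p) := DiffForm.d_eq_extDeriv (rAlpha α) p
  rw [h1, hev.extDeriv_eq, e]
  refine (extDeriv_smul_comp_fst (hα.contDiffAt_inChart (mem_extChartAt_target p.1)) u v).trans ?_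
  have h2 : (α.d p.1 : E₁ [⋀^Fin 2]→L[ℝ] ℝ) = extDeriv (α.inChart p.1) (extChartAt J p.1 p.1) :=
    DiffForm.d_eq_extDeriv α p.1
  have h3 : α.inChart p.1 (extChartAt J p.1 p.1) = α p.1 := DiffForm.inChart_self α p.1
  rw [h2, ← h3]
  rfl

end InducedForm

section SymplecticInduction

variable {E : Type*} [NormedAddCommGroup E] [NormedSpace ℝ E]
  {H : Type*} [TopologicalSpace H] {I : ModelWithCorners ℝ E H}
  {X : Type*} [TopologicalSpace X] [ChartedSpace H X] [IsManifold I ∞ X]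
  {L : X → Type*} [TopologicalSpace (TotalSpace ℂ L)]
  [∀ x, NormedAddCommGroup (L x)] [∀ x, InnerProductSpace ℂ (L x)]
  [FiberBundle ℂ L] [VectorBundle ℝ ℂ L] [VectorBundle ℂ ℂ L] [ContMDiffVectorBundle ∞ ℂ L I]
  {E₁ : Type*} [NormedAddCommGroup E₁] [NormedSpace ℝ E₁]
  {H₁ : Type*} [TopologicalSpace H₁] {J : ModelWithCorners ℝ E₁ H₁} [J.Boundaryless]
  [ChartedSpace H₁ (CircleBundle L)] [IsManifold J ∞ (CircleBundle L)]
  {nabla : CovariantDerivative I ℂ L} {α : DiffForm J (CircleBundle L) 1} {Ω : DiffForm I X 2}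

open CircleBundle

theorem CircleBundle.surjective_mfderiv_τ (hL : IsSmoothHermitian I L)
    (hL₁ : Manifold.IsSmoothEmbedding J (I.prod 𝓘(ℝ, ℂ)) ∞
      (Subtype.val : CircleBundle L → TotalSpace ℂ L)) (q : CircleBundle L)
    (v : TangentSpace I (τ q)) :
    ∃ w : TangentSpace J q, mfderiv J I (τ : CircleBundle L → X) q w = v := by
  obtain ⟨U, s, σ, hσ⟩ := exists_isLocalSection hL hL₁ q
  exact ⟨_, hσ.mfderiv_τ_mfderiv hL₁ v⟩

theorem CircleBundle.surjective_τ : Function.Surjective (τ : CircleBundle L → X) := by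
  intro x
  let e := (trivializationAt ℂ L x).continuousLinearEquivAt ℂ x
    (mem_baseSet_trivializationAt ℂ L x)
  let v : L x := e.symm 1
  refine ⟨⟨⟨x, (‖v‖⁻¹ : ℂ) • v⟩, ?_⟩, rfl⟩
  change ‖(‖v‖⁻¹ : ℂ) • v‖ = 1
  have h : ‖v‖ ≠ 0 := norm_ne_zero_iff.2 fun h => one_ne_zero (e.symm.map_eq_zero_iff.1 h)
  rw [norm_smul, norm_inv, Complex.norm_real, norm_norm, inv_mul_cancel₀ h]

theorem inducedForm_apply_of_curvature (hα : α.IsSmooth)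
    (hcurv : α.d = DiffForm.pullback CircleBundle.τ Ω) (p : InducedSpace L) (u v : E₁ × ℝ) :
    (inducedForm α p : (E₁ × ℝ) [⋀^Fin 2]→L[ℝ] ℝ) ![u, v]
      = u.2 * α p.1 ![v.1] - v.2 * α p.1 ![u.1]
        + (p.2 : ℝ) * Ω (τ p.1) ![mfderiv J I (τ : CircleBundle L → X) p.1 u.1,
          mfderiv J I (τ : CircleBundle L → X) p.1 v.1] := by
  refine (inducedForm_apply hα p u v).trans ?_
  rw [hcurv]
  congr 2
  refine congrArg (Ω (τ p.1)) ?_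
  ext i; fin_cases i <;> rfl

/-- The form `d(r α)` is symplectic. -/
theorem isSymplectic_inducedForm (hΩ : Ω.IsSymplectic) (hL : IsSmoothHermitian I L)
    (hL₁ : Manifold.IsSmoothEmbedding J (I.prod 𝓘(ℝ, ℂ)) ∞
      (Subtype.val : CircleBundle L → TotalSpace ℂ L)) (hα : IsConnectionForm nabla α)
    (hcurv : α.d = DiffForm.pullback CircleBundle.τ Ω) : (inducedForm α).IsSymplectic where
  smooth := (isSmooth_rAlpha hα.smooth).d
  closed := DiffForm.d_d (isSmooth_rAlpha hα.smooth)
  nondegenerate p u hu := by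
    have hu' : ∀ v : E₁ × ℝ, _ = (0 : ℝ) := fun v =>
      (inducedForm_apply_of_curvature hα.smooth hcurv p u v).symm.trans (hu v)
    obtain ⟨u₁, a⟩ := (u : E₁ × ℝ)
    have hα0 : ∀ β : TangentSpace J p.1 [⋀^Fin 1]→L[ℝ] ℝ, β ![0] = 0 := fun β => by
      have := apply_smul β 0 0
      rwa [zero_smul, zero_mul] at this
    have hΩ0 : ∀ x (v : TangentSpace I x), Ω x ![v, 0] = 0 := fun x v =>
      (Ω x).map_coord_zero 1 rfl
    have h1 : α p.1 ![u₁] = 0 := by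
      have h := hu' ((0 : E₁), 1)
      have e : mfderiv J I (τ : CircleBundle L → X) p.1 (0 : E₁) = 0 := map_zero _
      dsimp only at h
      have e' : α p.1 ![(0 : E₁)] = 0 := hα0 _
      rw [e, hΩ0, e'] at h
      linarith
    have h2 : a = 0 := by
      have h := hu' ((angular J p.1 : E₁), 0)
      dsimp only at h
      rw [mfderiv_τ_angular hL₁, hΩ0, connectionForm_angular hα] at h
      have := Real.pi_pos
      field_simp at h
      linarith
    have h3 : mfderiv J I (τ : CircleBundle L → X) p.1 u₁ = 0 := by
      refine hΩ.nondegenerate _ _ fun v => ?_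
      obtain ⟨w, rfl⟩ := surjective_mfderiv_τ hL hL₁ p.1 v
      have h := hu' ((w : E₁), 0)
      dsimp only at h
      rw [h2, zero_mul, zero_mul, sub_zero, zero_add] at h
      exact (mul_eq_zero.1 h).resolve_left (ne_of_gt p.2.2)
    obtain ⟨U, s, σ, hσ⟩ := exists_isLocalSection hL hL₁ p.1
    obtain ⟨c, rfl⟩ := hσ.exists_smul_angular hL₁ h3
    have h4 : c = 0 := by
      rw [apply_smul, connectionForm_angular hα] at h1
      have := Real.pi_pos
      field_simp at h1
      linarith
    rw [h2, h4, zero_smul]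
    rfl

theorem verticalField_spec
    (hL₁ : Manifold.IsSmoothEmbedding J (I.prod 𝓘(ℝ, ℂ)) ∞
      (Subtype.val : CircleBundle L → TotalSpace ℂ L)) (hα : IsConnectionForm nabla α)
    (q : CircleBundle L) :
    mfderiv J I (τ : CircleBundle L → X) q (verticalField I α q) = 0 ∧
      α q ![verticalField I α q] = -1 := by
  refine Classical.epsilon_spec (p := fun w : TangentSpace J q =>
    mfderiv J I (τ : CircleBundle L → X) q w = 0 ∧ α q ![w] = -1)
    ⟨(-(2 * Real.pi) : ℝ) • angular J q, ?_, ?_⟩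
  · rw [map_smul, mfderiv_τ_angular hL₁, smul_zero]
  · have := Real.pi_pos
    rw [apply_smul, connectionForm_angular hα]
    field_simp

theorem horizontalLift_spec (hL : IsSmoothHermitian I L)
    (hL₁ : Manifold.IsSmoothEmbedding J (I.prod 𝓘(ℝ, ℂ)) ∞
      (Subtype.val : CircleBundle L → TotalSpace ℂ L)) (hα : IsConnectionForm nabla α)
    (ξ : Π x : X, CTangent I x) (q : CircleBundle L) :
    oneForm (α q) (horizontalLift I α ξ q) = 0 ∧
    LinearMap.baseChange ℂ
      (mfderiv J I (τ : CircleBundle L → X) q : TangentSpace J q →ₗ[ℝ] TangentSpace I (τ q))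
      (horizontalLift I α ξ q) = ξ (τ q) := by
  have hlift : ∀ v : TangentSpace I (τ q), ∃ w : TangentSpace J q,
      α q ![w] = 0 ∧ mfderiv J I (τ : CircleBundle L → X) q w = v := fun v => by
    obtain ⟨w, rfl⟩ := surjective_mfderiv_τ hL hL₁ q v
    refine ⟨w + (-(2 * Real.pi * α q ![w]) : ℝ) • angular J q, ?_, ?_⟩
    · have := Real.pi_pos
      rw [apply_add, apply_smul, connectionForm_angular hα]
      field_simp
      ring
    · rw [map_add, map_smul, mfderiv_τ_angular hL₁, smul_zero, add_zero]
  obtain ⟨a, b, hab⟩ := exists_re_im (ξ (τ q))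
  obtain ⟨a', ha, rfl⟩ := hlift a
  obtain ⟨b', hb, rfl⟩ := hlift b
  refine Classical.epsilon_spec (p := fun w : CTangent J q => oneForm (α q) w = 0 ∧
    LinearMap.baseChange ℂ
      (mfderiv J I (τ : CircleBundle L → X) q : TangentSpace J q →ₗ[ℝ] TangentSpace I (τ q)) w
      = ξ (τ q)) ⟨(1 : ℂ) ⊗ₜ[ℝ] a' + Complex.I ⊗ₜ[ℝ] b', ?_, ?_⟩
  · rw [map_add, oneForm_tmul, oneForm_tmul, ha, hb]
    simp
  · rw [map_add, LinearMap.baseChange_tmul, LinearMap.baseChange_tmul, hab]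
    rfl

theorem oneForm_etaField (hL : IsSmoothHermitian I L)
    (hL₁ : Manifold.IsSmoothEmbedding J (I.prod 𝓘(ℝ, ℂ)) ∞
      (Subtype.val : CircleBundle L → TotalSpace ℂ L)) (hα : IsConnectionForm nabla α)
    (Ω : DiffForm I X 2) (φ : X → ℂ) (q : CircleBundle L) :
    oneForm (α q) (etaField Ω α φ q) = -φ (τ q) := by
  rw [etaField, map_add, map_smul, (horizontalLift_spec hL hL₁ hα _ q).1, oneForm_tmul,
    (verticalField_spec hL₁ hα q).2]
  simp

theorem baseChange_etaField (hL : IsSmoothHermitian I L)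
    (hL₁ : Manifold.IsSmoothEmbedding J (I.prod 𝓘(ℝ, ℂ)) ∞
      (Subtype.val : CircleBundle L → TotalSpace ℂ L)) (hα : IsConnectionForm nabla α)
    (Ω : DiffForm I X 2) (φ : X → ℂ) (q : CircleBundle L) :
    LinearMap.baseChange ℂ
      (mfderiv J I (τ : CircleBundle L → X) q : TangentSpace J q →ₗ[ℝ] TangentSpace I (τ q))
      (etaField Ω α φ q) = hamiltonianField Ω φ (τ q) := by
  have h : (mfderiv J I (τ : CircleBundle L → X) q : TangentSpace J q →ₗ[ℝ] TangentSpace I (τ q))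
      (verticalField I α q) = 0 := (verticalField_spec hL₁ hα q).1
  rw [etaField, map_add, map_smul, (horizontalLift_spec hL hL₁ hα _ q).2,
    LinearMap.baseChange_tmul, h, TensorProduct.tmul_zero, smul_zero, add_zero]

theorem mfderiv_mk_left_apply (p : InducedSpace L) (u : TangentSpace J p.1) :
    (mfderiv J (J.prod 𝓘(ℝ, ℝ)) (fun q : CircleBundle L => ((q, p.2) : InducedSpace L)) p.1 u :
      E₁ × ℝ) = (u, 0) := by
  rw [mfderiv_prod_left]
  rfl

theorem twoForm_inducedForm_extendField (hα : α.IsSmooth)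
    (hcurv : α.d = DiffForm.pullback CircleBundle.τ Ω) (η : Π q : CircleBundle L, CTangent J q)
    (p : InducedSpace L) (v : TangentSpace (J.prod 𝓘(ℝ, ℝ)) p) :
    twoForm (inducedForm α p) (extendField η p) (1 ⊗ₜ[ℝ] v)
      = -(((v : E₁ × ℝ).2 : ℝ) : ℂ) * oneForm (α p.1) (η p.1)
        + ((p.2 : ℝ) : ℂ) * twoForm (Ω (τ p.1)) (LinearMap.baseChange ℂ
          (mfderiv J I (τ : CircleBundle L → X) p.1 :
            TangentSpace J p.1 →ₗ[ℝ] TangentSpace I (τ p.1)) (η p.1))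
          (1 ⊗ₜ[ℝ] mfderiv J I (τ : CircleBundle L → X) p.1 (v : E₁ × ℝ).1) := by
  rw [extendField]
  generalize η p.1 = ξ
  induction ξ using TensorProduct.induction_on with
  | zero => simp
  | add ξ ξ' h h' =>
    simp only [map_add, LinearMap.add_apply, h, h']
    ring
  | tmul z u =>
    have h := inducedForm_apply_of_curvature hα hcurv p (u, 0) v
    rw [LinearMap.baseChange_tmul, LinearMap.baseChange_tmul, twoForm_tmul, twoForm_tmul,
      oneForm_tmul]
    have e : inducedForm α p ![(mfderiv J (J.prod 𝓘(ℝ, ℝ))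
        (fun q : CircleBundle L => ((q, p.2) : InducedSpace L)) p.1 u), v] = _ :=
      (congrArg (fun w : E₁ × ℝ => (inducedForm α p : (E₁ × ℝ) [⋀^Fin 2]→L[ℝ] ℝ) ![w, v])
        (mfderiv_mk_left_apply p u)).trans h
    refine (congrArg (fun a : ℝ => z * 1 * (a : ℂ)) e).trans ?_
    change _ = -(((v : E₁ × ℝ).2 : ℝ) : ℂ) * (z * (α p.1 ![u] : ℝ)) + ((p.2 : ℝ) : ℂ) *
      (z * 1 * (Ω (τ p.1) ![mfderiv J I (τ : CircleBundle L → X) p.1 u, _] : ℝ))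
    push_cast
    ring

theorem isSmoothFun_radius : IsSmoothFun (J.prod 𝓘(ℝ, ℝ))
    (fun p : InducedSpace L => ((p.2 : ℝ) : ℂ)) :=
  .ofReal (contMDiff_posReals_val.comp contMDiff_snd)

theorem isSmoothFun_comp_τ_fst
    (hL₁ : Manifold.IsSmoothEmbedding J (I.prod 𝓘(ℝ, ℂ)) ∞
      (Subtype.val : CircleBundle L → TotalSpace ℂ L)) {φ : X → ℂ} (hφ : IsSmoothFun I φ) :
    IsSmoothFun (J.prod 𝓘(ℝ, ℝ)) (fun p : InducedSpace L => φ (τ p.1)) :=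
  hφ.comp ((contMDiff_τ hL₁).comp contMDiff_fst)

theorem isSmoothFun_rTilde
    (hL₁ : Manifold.IsSmoothEmbedding J (I.prod 𝓘(ℝ, ℂ)) ∞
      (Subtype.val : CircleBundle L → TotalSpace ℂ L)) {φ : X → ℂ} (hφ : IsSmoothFun I φ) :
    IsSmoothFun (J.prod 𝓘(ℝ, ℝ)) (rTilde (L := L) φ) :=
  isSmoothFun_radius.mul (isSmoothFun_comp_τ_fst hL₁ hφ)

theorem mvfderiv_radius (p : InducedSpace L) (v : TangentSpace (J.prod 𝓘(ℝ, ℝ)) p) :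
    mvfderiv (J.prod 𝓘(ℝ, ℝ)) (fun p : InducedSpace L => ((p.2 : ℝ) : ℂ)) p v
      = (((v : E₁ × ℝ).2 : ℝ) : ℂ) := by
  have h1 : MDifferentiableAt 𝓘(ℝ, ℝ) 𝓘(ℝ, ℝ) (Subtype.val : PosReals → ℝ) p.2 :=
    contMDiff_posReals_val.mdifferentiableAt (by simp)
  have h2 := mfderiv_comp_apply (I := J.prod 𝓘(ℝ, ℝ)) p h1 mdifferentiableAt_snd v
  have h3 := mfderiv_comp_apply (I := J.prod 𝓘(ℝ, ℝ)) p
    Complex.ofRealCLM.differentiableAt.mdifferentiableAt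
    (h1.comp p (mdifferentiableAt_snd (I := J) (M := CircleBundle L))) v
  refine h3.trans ?_
  rw [mfderiv_eq_fderiv, Complex.ofRealCLM.fderiv]
  refine congrArg Complex.ofRealCLM (h2.trans ?_)
  rw [mfderiv_snd]
  exact mvfderiv_posReals_val p.2 _

theorem mvfderiv_comp_τ_fst
    (hL₁ : Manifold.IsSmoothEmbedding J (I.prod 𝓘(ℝ, ℂ)) ∞
      (Subtype.val : CircleBundle L → TotalSpace ℂ L)) {φ : X → ℂ} (hφ : IsSmoothFun I φ)
    (p : InducedSpace L) (v : TangentSpace (J.prod 𝓘(ℝ, ℝ)) p) :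
    mvfderiv (J.prod 𝓘(ℝ, ℝ)) (fun p : InducedSpace L => φ (τ p.1)) p v
      = mvfderiv I φ (τ p.1) (mfderiv J I (τ : CircleBundle L → X) p.1 (v : E₁ × ℝ).1) := by
  have h1 := mfderiv_comp_apply (I := J.prod 𝓘(ℝ, ℝ)) (M := InducedSpace L) p
    (mdifferentiableAt_τ hL₁ p.1) mdifferentiableAt_fst v
  have h2 := mfderiv_comp_apply (I := J.prod 𝓘(ℝ, ℝ)) p (hφ.mdifferentiableAt (τ p.1))
    ((mdifferentiableAt_τ hL₁ p.1).comp p mdifferentiableAt_fst) v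
  refine h2.trans (congrArg (mvfderiv I φ (τ p.1)) (h1.trans ?_))
  rw [mfderiv_fst]
  rfl

theorem cderiv_rTilde_tmul
    (hL₁ : Manifold.IsSmoothEmbedding J (I.prod 𝓘(ℝ, ℂ)) ∞
      (Subtype.val : CircleBundle L → TotalSpace ℂ L)) {φ : X → ℂ} (hφ : IsSmoothFun I φ)
    (p : InducedSpace L) (v : TangentSpace (J.prod 𝓘(ℝ, ℝ)) p) :
    cderiv (J.prod 𝓘(ℝ, ℝ)) (rTilde φ) p (1 ⊗ₜ[ℝ] v)
      = (((v : E₁ × ℝ).2 : ℝ) : ℂ) * φ (τ p.1) + ((p.2 : ℝ) : ℂ) * cderiv I φ (τ p.1)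
        (1 ⊗ₜ[ℝ] mfderiv J I (τ : CircleBundle L → X) p.1 (v : E₁ × ℝ).1) := by
  have h := cderiv_mul (isSmoothFun_radius.mdifferentiableAt p)
    ((isSmoothFun_comp_τ_fst hL₁ hφ).mdifferentiableAt p) ((1 : ℂ) ⊗ₜ[ℝ] v)
  rw [cderiv_tmul, cderiv_tmul, cderiv_tmul, mvfderiv_radius, mvfderiv_comp_τ_fst hL₁ hφ] at h
  rw [cderiv_tmul, cderiv_tmul, one_mul, one_mul]
  rw [one_mul, one_mul, one_mul] at h
  exact h

/-- The extension of `η_φ` is a Hamiltonian vector field of `r φ̃`. -/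
theorem isHamiltonianField_etaField [FiniteDimensional ℝ E] (hΩ : Ω.IsSymplectic)
    (hL : IsSmoothHermitian I L)
    (hL₁ : Manifold.IsSmoothEmbedding J (I.prod 𝓘(ℝ, ℂ)) ∞
      (Subtype.val : CircleBundle L → TotalSpace ℂ L)) (hα : IsConnectionForm nabla α)
    (hcurv : α.d = DiffForm.pullback CircleBundle.τ Ω) {φ : X → ℂ} (hφ : IsSmoothFun I φ) :
    IsHamiltonianField (inducedForm α) (rTilde φ) (extendField (etaField Ω α φ)) := by
  refine fun p => linearMap_ext fun v => ?_
  rw [cderiv_rTilde_tmul hL₁ hφ, twoForm_inducedForm_extendField hα.smooth hcurv,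
    oneForm_etaField hL hL₁ hα, baseChange_etaField hL hL₁ hα,
    hamiltonianField_spec (hΩ.nondegenerate _)]
  ring

theorem cderiv_rTilde_extendField
    (hL₁ : Manifold.IsSmoothEmbedding J (I.prod 𝓘(ℝ, ℂ)) ∞
      (Subtype.val : CircleBundle L → TotalSpace ℂ L)) {φ : X → ℂ} (hφ : IsSmoothFun I φ)
    (η : Π q : CircleBundle L, CTangent J q) (p : InducedSpace L) :
    cderiv (J.prod 𝓘(ℝ, ℝ)) (rTilde φ) p (extendField η p)
      = ((p.2 : ℝ) : ℂ) * cderiv I φ (τ p.1) (LinearMap.baseChange ℂ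
          (mfderiv J I (τ : CircleBundle L → X) p.1 :
            TangentSpace J p.1 →ₗ[ℝ] TangentSpace I (τ p.1)) (η p.1)) := by
  have h : MDifferentiableAt J (J.prod 𝓘(ℝ, ℝ))
      (fun q : CircleBundle L => ((q, p.2) : InducedSpace L)) p.1 :=
    mdifferentiableAt_id.prodMk mdifferentiableAt_const
  have h1 := cderiv_comp ((isSmoothFun_rTilde hL₁ hφ).mdifferentiableAt p) h (η p.1)
  have h2 : IsSmoothFun J (fun q : CircleBundle L => φ (τ q)) := hφ.comp (contMDiff_τ hL₁)
  have h3 : rTilde φ ∘ (fun q : CircleBundle L => ((q, p.2) : InducedSpace L))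
      = ((p.2 : ℝ) : ℂ) • (fun q : CircleBundle L => φ (τ q)) := rfl
  rw [h3, cderiv_smul _ (h2.mdifferentiableAt _)] at h1
  refine h1.symm.trans ?_
  rw [LinearMap.smul_apply, smul_eq_mul]
  congr 1
  exact cderiv_comp (hφ.mdifferentiableAt _) (mdifferentiableAt_τ hL₁ p.1) (η p.1)

theorem poissonBracket_rTilde [FiniteDimensional ℝ E] (hΩ : Ω.IsSymplectic)
    (hL : IsSmoothHermitian I L)
    (hL₁ : Manifold.IsSmoothEmbedding J (I.prod 𝓘(ℝ, ℂ)) ∞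
      (Subtype.val : CircleBundle L → TotalSpace ℂ L)) (hα : IsConnectionForm nabla α)
    (hcurv : α.d = DiffForm.pullback CircleBundle.τ Ω) {φ : X → ℂ} (hφ : IsSmoothFun I φ)
    (f : InducedSpace L → ℂ) (p : InducedSpace L) :
    poissonBracket (inducedForm α) (rTilde φ) f p
      = cderiv (J.prod 𝓘(ℝ, ℝ)) f p (extendField (etaField Ω α φ) p) :=
  poissonBracket_eq ((isSymplectic_inducedForm hΩ hL hL₁ hα hcurv).nondegenerate p)
    (isHamiltonianField_etaField hΩ hL hL₁ hα hcurv hφ p)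

theorem isPoissonLieMonomorphism_rTilde [FiniteDimensional ℝ E] (hΩ : Ω.IsSymplectic)
    (hL : IsSmoothHermitian I L)
    (hL₁ : Manifold.IsSmoothEmbedding J (I.prod 𝓘(ℝ, ℂ)) ∞
      (Subtype.val : CircleBundle L → TotalSpace ℂ L)) (hα : IsConnectionForm nabla α)
    (hcurv : α.d = DiffForm.pullback CircleBundle.τ Ω) :
    IsPoissonLieMonomorphism Ω (inducedForm α) (rTilde (L := L)) where
  smooth _ hf := isSmoothFun_rTilde hL₁ hf
  map_add _ _ _ _ := funext fun _ => mul_add _ _ _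
  map_smul _ _ _ := funext fun _ => mul_left_comm _ _ _
  injective f _ g _ h := by
    funext x
    obtain ⟨q, rfl⟩ := surjective_τ (L := L) x
    simpa [rTilde] using congrFun h (q, ⟨1, (one_pos : (0 : ℝ) < 1)⟩)
  map_bracket f g hf hg := by
    funext p
    rw [poissonBracket_rTilde hΩ hL hL₁ hα hcurv hf, cderiv_rTilde_extendField hL₁ hg,
      baseChange_etaField hL hL₁ hα]
    rfl

/-- The complex linear extension of the formula for the derivative of `s̃`. -/
theorem cderiv_tildeSection_smul (hL : IsSmoothHermitian I L)
    (hnabla : IsHermitianConnection nabla)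
    (hL₁ : Manifold.IsSmoothEmbedding J (I.prod 𝓘(ℝ, ℂ)) ∞
      (Subtype.val : CircleBundle L → TotalSpace ℂ L))
    (hα : IsConnectionForm nabla α) {t : Π x, L x}
    (ht : IsSmoothSectionOn I t Set.univ) (q : CircleBundle L) (ξ : CTangent J q) :
    cderiv J (tildeSection t) q ξ • (q.1.2 : L (τ q))
      = LinearMap.liftBaseChange ℂ (nabla t (τ q) : TangentSpace I (τ q) →ₗ[ℝ] L (τ q))
          (LinearMap.baseChange ℂ (mfderiv J I (τ : CircleBundle L → X) q :
            TangentSpace J q →ₗ[ℝ] TangentSpace I (τ q)) ξ)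
        - (2 * Real.pi * Complex.I * oneForm (α q) ξ) • t (τ q) := by
  induction ξ using TensorProduct.induction_on with
  | zero =>
    simp
    rfl
  | add ξ ξ' h h' =>
    simp only [map_add, add_smul, mul_add, h, h']
    abel
  | tmul z w =>
    rw [cderiv_tmul, LinearMap.baseChange_tmul, LinearMap.liftBaseChange_tmul, oneForm_tmul,
      mul_left_comm _ z, mul_smul z, mul_smul z]
    refine (congrArg (fun a : L (τ q) => z • a)
      (mvfderiv_tildeSection_smul hL hnabla hL₁ hα ht q w)).trans ?_
    exact smul_sub z _ _

theorem CircleBundle.tildeSection_eq {t : Π x, L x} {q : CircleBundle L} {c : ℂ}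
    (h : c • (q.1.2 : L (τ q)) = t (τ q)) : tildeSection t q = c := by
  have h1 : inner ℂ (q.1.2 : L (τ q)) (q.1.2 : L (τ q)) = (1 : ℂ) := by
    rw [inner_self_eq_norm_sq_to_K, show ‖(q.1.2 : L (τ q))‖ = 1 from q.2]
    simp
  change inner ℂ (q.1.2 : L (τ q)) (t (τ q)) = c
  rw [← h, inner_smul_right, h1, mul_one]

theorem tildeSectionExt_prequantization [FiniteDimensional ℝ E] (hΩ : Ω.IsSymplectic)
    (hL : IsSmoothHermitian I L) (hnabla : IsHermitianConnection nabla)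
    (hL₁ : Manifold.IsSmoothEmbedding J (I.prod 𝓘(ℝ, ℂ)) ∞
      (Subtype.val : CircleBundle L → TotalSpace ℂ L)) (hα : IsConnectionForm nabla α)
    (hcurv : α.d = DiffForm.pullback CircleBundle.τ Ω) {φ : X → ℂ} (hφ : IsSmoothFun I φ)
    {s : Π x, L x} (hs : IsSmoothSectionOn I s Set.univ) :
    tildeSectionExt (prequantization Ω nabla φ s)
      = poissonBracket (inducedForm α) (rTilde φ) (tildeSectionExt s) := by
  funext p
  rw [poissonBracket_rTilde hΩ hL hL₁ hα hcurv hφ]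
  have h : MDifferentiableAt J (J.prod 𝓘(ℝ, ℝ))
      (fun q : CircleBundle L => ((q, p.2) : InducedSpace L)) p.1 :=
    mdifferentiableAt_id.prodMk mdifferentiableAt_const
  have hsm : IsSmoothFun J (tildeSection s) := contMDiff_tildeSection hL hL₁ hs
  have hext : IsSmoothFun (J.prod 𝓘(ℝ, ℝ)) (tildeSectionExt s) := hsm.comp contMDiff_fst
  have h1 := cderiv_comp (hext.mdifferentiableAt p) h (etaField Ω α φ p.1)
  have h3 : tildeSectionExt s ∘ (fun q : CircleBundle L => ((q, p.2) : InducedSpace L))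
      = tildeSection s := rfl
  rw [h3] at h1
  have h2 := cderiv_tildeSection_smul hL hnabla hL₁ hα hs p.1 (etaField Ω α φ p.1)
  rw [baseChange_etaField hL hL₁ hα, oneForm_etaField hL hL₁ hα] at h2
  refine Eq.trans ?_ h1
  refine tildeSection_eq (h2.trans ?_)
  rw [prequantization, mul_neg, neg_smul, sub_neg_eq_add]

end SymplecticInduction

end

theorem theorem1p7
    -- the connected symplectic manifold `(X, Ω)`
    {E : Type*} [NormedAddCommGroup E] [NormedSpace ℝ E] [FiniteDimensional ℝ E]
    {H : Type*} [TopologicalSpace H] (I : ModelWithCorners ℝ E H) [I.Boundaryless]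
    {X : Type*} [TopologicalSpace X] [ChartedSpace H X] [IsManifold I ∞ X]
    [T2Space X] [SecondCountableTopology X] [ConnectedSpace X]
    (Ω : DiffForm I X 2) (hΩ : Ω.IsSymplectic)
    -- the smooth Hermitian complex line bundle `L` with its Hermitian connection
    (L : X → Type*) [TopologicalSpace (TotalSpace ℂ L)]
    [∀ x, NormedAddCommGroup (L x)] [∀ x, InnerProductSpace ℂ (L x)]
    [FiberBundle ℂ L] [VectorBundle ℝ ℂ L] [VectorBundle ℂ ℂ L] [ContMDiffVectorBundle ∞ ℂ L I]
    (hL : IsSmoothHermitian I L)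
    (nabla : CovariantDerivative I ℂ L) (hnabla : IsHermitianConnection nabla)
    -- the circle bundle, an embedded submanifold of the total space of `L`
    {E₁ : Type*} [NormedAddCommGroup E₁] [NormedSpace ℝ E₁] [FiniteDimensional ℝ E₁]
    {H₁ : Type*} [TopologicalSpace H₁] (J : ModelWithCorners ℝ E₁ H₁) [J.Boundaryless]
    [ChartedSpace H₁ (CircleBundle L)] [IsManifold J ∞ (CircleBundle L)]
    (hL₁ : Manifold.IsSmoothEmbedding J (I.prod 𝓘(ℝ, ℂ)) ∞
      (Subtype.val : CircleBundle L → TotalSpace ℂ L))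
    -- the connection form, and `Ω` as the curvature of the connection: `dα = τ^*Ω`
    (α : DiffForm J (CircleBundle L) 1) (hα : IsConnectionForm nabla α)
    (hcurv : α.d = DiffForm.pullback CircleBundle.τ Ω) :
    (inducedForm α).IsSymplectic ∧
    IsPoissonLieAlgebra Ω ∧
    IsPoissonLieAlgebra (inducedForm α) ∧
    IsPoissonLieMonomorphism Ω (inducedForm α) (rTilde (L := L)) ∧
    (∀ φ : X → ℂ, IsSmoothFun I φ →
      IsHamiltonianField (inducedForm α) (rTilde φ) (extendField (etaField Ω α φ)) ∧
      extendField (etaField Ω α φ) = hamiltonianField (inducedForm α) (rTilde φ)) ∧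
    (∀ (φ : X → ℂ) (s : Π x, L x), IsSmoothFun I φ → IsSmoothSectionOn I s Set.univ →
      tildeSectionExt (prequantization Ω nabla φ s)
        = poissonBracket (inducedForm α) (rTilde φ) (tildeSectionExt s)) := by
  have hX := isSymplectic_inducedForm hΩ hL hL₁ hα hcurv
  refine ⟨hX, hΩ.isPoissonLieAlgebra, hX.isPoissonLieAlgebra,
    isPoissonLieMonomorphism_rTilde hΩ hL hL₁ hα hcurv, fun φ hφ => ?_, fun φ s hφ hs =>
    tildeSectionExt_prequantization hΩ hL hnabla hL₁ hα hcurv hφ hs⟩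
  have hη := isHamiltonianField_etaField hΩ hL hL₁ hα hcurv hφ
  exact ⟨hη, funext fun p => (hamiltonianField_eq (hX.nondegenerate p) (hη p)).symm⟩
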